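/- Let $A$ be a fixed right-angled Artin group, given by a finite simple graph $\Gamma$ with vertices $a_1,\dots,a_N$: the group $A$ is generated by $a_1,\dots,a_N$, subject to the relations $a_ia_j=a_ja_i$ for all pairs $a_i,a_j$ that are not joined by an edge of $\Gamma$ (so edges join non-commuting generators). For a word $w$ in the letters $a_i^{\pm1}$ let $[w]\in A$ be the element it represents, and let $\Delta(w)$ be the full subgraph of $\Gamma$ on the generators occurring in $w$. A word is *reduced* if it has no subword $a_i^{\pm1}xa_i^{\mp1}$ in which all letters of $x$ commute with $a_i$; it is *cyclically reduced* if it is reduced and not of the form $x_1a_i^{\pm1}x_2a_i^{\mp1}x_3$ in which all letters of $x_1$ and $x_3$ commute with $a_i$. A nontrivial reduced word $w$ is *non-split* if $\Delta(w)$ is connected. A reduced word is *normal* if for each of its nonempty suffixes $v$ the index of the first letter of $v$ is at least the index of the first letter of any reduced word representing $[v]$. A cyclically reduced word is a *cyclic normal form* if it and all its cyclic permutations are normal. There is an algorithm with the following properties. Its input is a cyclically reduced word $w$, given as a product $w=w_1\cdots w_k$ ($k\ge 0$) of non-split words $w_1,\dots,w_k$ in cyclic normal form, one for each connected component of $\Delta(w)$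 (that is, for $i\ne j$ the generators occurring in $w_i$ are different from, and commute with, those occurring in $w_j$). It runs on a random access machine (with addition and subtraction at unit cost) in time at most $C(\ell+1)$, where $\ell$ is the length of $w$ and the constant $C$ and the program depend only on $\Gamma$; moreover, the numbers held in its registers never exceed $C(\ell+1)$. Its output is the canonical generating set of the centralizer of $[w]$ in $A$, which consists of 1. words $z_1,\dots,z_k$, where $z_i$ is the minimal root of $w_i$: the word $z_i$ is cyclically reduced, $[z_i]$ generates the unique maximal infinite cyclic subgroup of $A$ containing $[w_i]$, and there is an equality of words $w_i=z_i^{r_i}$, where $r_i$ is the largest integer $r$ for which the word $w_i$ is the $r$-th power of a word; 2. the generators among $a_1,\dots,a_N$ that commute with all generators occurring in $w$. The elements represented by this output generate the centralizer of $[w]$ in $A$. -/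

import Mathlib

/-! ### Right-angled Artin groups, words and normal forms -/

namespace RAAG

/-- Words in the letters `a_i^{±1}`; the letter `a_i` is `(i, true)` and `a_i⁻¹` is `(i, false)`. -/
abbrev Word (N : ℕ) : Type := List (Fin N × Bool)

/-- Two generators commute exactly when the corresponding vertices are not joined by an edge. -/
def GenCommute {N : ℕ} (Γ : SimpleGraph (Fin N)) (a b : Fin N) : Prop := ¬ Γ.Adj a b

/-- The defining relators: commutators of the pairs of commuting generators. -/
def relators {N : ℕ} (Γ : SimpleGraph (Fin N)) : Set (FreeGroup (Fin N)) :=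
  {r | ∃ a b : Fin N, GenCommute Γ a b ∧ 
    r = FreeGroup.of a * FreeGroup.of b * (FreeGroup.of a)⁻¹ * (FreeGroup.of b)⁻¹}

/-- The right-angled Artin group with defining graph `Γ` (edges join non-commuting generators). -/
abbrev RAAGroup {N : ℕ} (Γ : SimpleGraph (Fin N)) : Type := PresentedGroup (relators Γ)

/-- The generator `a_i` as an element of the group. -/
def gen {N : ℕ} (Γ : SimpleGraph (Fin N)) (a : Fin N) : RAAGroup Γ := PresentedGroup.of a

/-- The element `[w]` of the group represented by the word `w`. -/
def elt {N : ℕ} (Γ : SimpleGraph (Fin N)) (w : Word N) : RAAGroup Γ :=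
  PresentedGroup.mk (relators Γ) (FreeGroup.mk w)

/-- A word is reduced if it has no subword `a^{±1} x a^{∓1}` in which all letters of `x`
commute with `a`. -/
def Reduced {N : ℕ} (Γ : SimpleGraph (Fin N)) (w : Word N) : Prop :=
  ¬ ∃ (u x v : Word N) (a : Fin N) (ε : Bool),
    w = u ++ [(a, ε)] ++ x ++ [(a, !ε)] ++ v ∧ ∀ l ∈ x, GenCommute Γ a l.1

/-- A word is cyclically reduced if it is reduced and not of the form `x₁ a^{±1} x₂ a^{∓1} x₃`
in which all letters of `x₁` and `x₃` commute with `a`. -/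
def CyclicallyReduced {N : ℕ} (Γ : SimpleGraph (Fin N)) (w : Word N) : Prop :=
  Reduced Γ w ∧ ¬ ∃ (x₁ x₂ x₃ : Word N) (a : Fin N) (ε : Bool),
    w = x₁ ++ [(a, ε)] ++ x₂ ++ [(a, !ε)] ++ x₃ ∧
      (∀ l ∈ x₁, GenCommute Γ a l.1) ∧ ∀ l ∈ x₃, GenCommute Γ a l.1

/-- The (reduced) word `w` is trivial, or the index of its first letter is at least the index of
the first letter of every reduced word that represents the same element. -/
def InitiallyNormal {N : ℕ} (Γ : SimpleGraph (Fin N)) (w : Word N) : Prop :=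
  ∀ (l : Fin N × Bool) (t : Word N), w = l :: t →
    ∀ (l' : Fin N × Bool) (t' : Word N), Reduced Γ (l' :: t') →
      elt Γ (l' :: t') = elt Γ w → l'.1 ≤ l.1

/-- A reduced word is normal if all its suffixes are initially normal. -/
def Normal {N : ℕ} (Γ : SimpleGraph (Fin N)) (w : Word N) : Prop :=
  Reduced Γ w ∧ ∀ v : Word N, v <:+ w → InitiallyNormal Γ v

/-- A cyclic normal form: a cyclically reduced word all of whose cyclic permutations
(including the word itself) are normal. -/
def CyclicNormalForm {N : ℕ} (Γ : SimpleGraph (Fin N)) (w : Word N) : Prop :=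
  CyclicallyReduced Γ w ∧ ∀ v : Word N, v ~r w → Normal Γ v

/-- The set of generators occurring in `w`, with either exponent. -/
def support {N : ℕ} (w : Word N) : Set (Fin N) := {a | ∃ l ∈ w, l.1 = a}

/-- A non-trivial reduced word is non-split if the full subgraph on its support is connected. -/
def NonSplit {N : ℕ} (Γ : SimpleGraph (Fin N)) (w : Word N) : Prop :=
  w ≠ [] ∧ Reduced Γ w ∧ (Γ.induce (support w)).Connected

/-- `ws = [w₁, …, w_k]` is a decomposition of the cyclically reduced word `w₁ ⋯ w_k` into
non-split cyclic normal forms, one for each connected component of the full subgraph on the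
support of `w₁ ⋯ w_k`: there are no edges between the supports of distinct factors, which
are disjoint, and the support of each factor is connected. -/
structure IsNonSplitDecomposition {N : ℕ} (Γ : SimpleGraph (Fin N)) (ws : List (Word N)) :
    Prop where
  cyclicallyReduced : CyclicallyReduced Γ ws.flatten
  cyclicNormalForm : ∀ w ∈ ws, CyclicNormalForm Γ w
  nonSplit : ∀ w ∈ ws, NonSplit Γ w
  separated : ws.Pairwise fun u v =>
    ∀ a ∈ support u, ∀ b ∈ support v, a ≠ b ∧ GenCommute Γ a b

/-! ### The canonical generating set of the centralizer -/

/-- The word `z^r`. -/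
def wordPow {N : ℕ} (z : Word N) (r : ℕ) : Word N := (List.replicate r z).flatten

/-- `K` is an infinite cyclic subgroup containing `g`. -/
def IsInfiniteCyclicThrough {G : Type} [Group G] (g : G) (K : Subgroup G) : Prop :=
  IsCyclic K ∧ Infinite K ∧ g ∈ K

/-- The cyclically reduced word `z` is the minimal root of the word `w`: the element `[z]`
generates the unique maximal infinite cyclic subgroup containing `[w]`, and, as a word, `w` is a
power `z^r`, where `r` is the largest exponent for which `w` is the `r`-th power of a word. -/
structure IsMinimalRoot {N : ℕ} (Γ : SimpleGraph (Fin N)) (w z : Word N) : Prop where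
  cyclicallyReduced : CyclicallyReduced Γ z
  maximal : Maximal (IsInfiniteCyclicThrough (elt Γ w)) (Subgroup.zpowers (elt Γ z))
  unique : ∀ K : Subgroup (RAAGroup Γ), Maximal (IsInfiniteCyclicThrough (elt Γ w)) K →
    K = Subgroup.zpowers (elt Γ z)
  power : ∃ r : ℕ, w = wordPow z r ∧ ∀ (z' : Word N) (r' : ℕ), w = wordPow z' r' → r' ≤ r

/-- The list `out` of words enumerates the canonical generating set for the centralizer of
`w₁ ⋯ w_k`: first the minimal roots of `w₁, …, w_k`, then, each once, the generators that commute
with all generators occurring in `w₁ ⋯ w_k`. -/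
def IsCanonicalGeneratingList {N : ℕ} (Γ : SimpleGraph (Fin N)) (ws out : List (Word N)) : Prop :=
  ∃ (zs : List (Word N)) (gs : List (Fin N)),
    out = zs ++ gs.map (fun a => [(a, true)]) ∧
    List.Forall₂ (IsMinimalRoot Γ) ws zs ∧
    gs.Nodup ∧
    ∀ a : Fin N, a ∈ gs ↔ ∀ b ∈ support ws.flatten, Commute (gen Γ a) (gen Γ b)

/-- Letters are coded by numbers `≥ 2`. -/
def letterCode {N : ℕ} (l : Fin N × Bool) : ℕ := 2 * (l.1 : ℕ) + (if l.2 then 2 else 3)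

/-- A list of words is coded over a finite alphabet: every word is followed by the separator `1`,
and the list is followed by the end mark `0`. -/
def encode {N : ℕ} (ws : List (Word N)) : List ℕ :=
  ws.flatMap (fun w => w.map letterCode ++ [1]) ++ [0]

end RAAG

/-! ### Random access machines

Registers `0, 1, 2, …` hold natural numbers. There is a read-only input tape and a write-only
output tape. Every instruction costs one unit of time. -/

namespace RAM

/-- A constant, the content of register `r`, or the content of the register whose address is
in register `r`. -/
inductive Source where
  | imm (c : ℕ)
  | reg (r : ℕ)
  | ind (r : ℕ)

/-- Register `r`, or the register whose address is in register `r`. -/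
inductive Target where
  | reg (r : ℕ)
  | ind (r : ℕ)

inductive Instr where
  /-- copy a value -/
  | mov (d : Target) (x : Source)
  /-- addition -/
  | add (d : Target) (x y : Source)
  /-- truncated subtraction `max (x - y) 0` -/
  | sub (d : Target) (x y : Source)
  /-- jump to instruction `k` if the value is zero -/
  | jz (x : Source) (k : ℕ)
  /-- read the next input symbol (`0` if the input is exhausted) -/
  | read (d : Target)
  /-- append a value to the output -/
  | write (x : Source)
  | halt

/-- A program is a finite list of instructions, numbered from `0`. -/
abbrev Program : Type := List Instr

structure Config where
  pc : ℕ
  mem : ℕ → ℕ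
  input : List ℕ
  output : List ℕ

def Config.val (c : Config) : Source → ℕ
  | .imm n => n
  | .reg r => c.mem r
  | .ind r => c.mem (c.mem r)

def Config.addr (c : Config) : Target → ℕ
  | .reg r => r
  | .ind r => c.mem r

/-- Store `n` at `d` and move on to the next instruction. -/
def Config.put (c : Config) (d : Target) (n : ℕ) : Config :=
  { c with pc := c.pc + 1, mem := Function.update c.mem (c.addr d) n }

/-- The effect of one instruction; `none` means that the machine stops. -/
def exec (c : Config) : Instr → Option Config
  | .mov d x => some (c.put d (c.val x))
  | .add d x y => some (c.put d (c.val x + c.val y))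
  | .sub d x y => some (c.put d (c.val x - c.val y))
  | .jz x k => some { c with pc := if c.val x = 0 then k else c.pc + 1 }
  | .read d => some { c.put d (c.input.headD 0) with input := c.input.tail }
  | .write x => some { c with pc := c.pc + 1, output := c.output ++ [c.val x] }
  | .halt => none

/-- One step of the program; the machine also stops if there is no instruction to execute. -/
def step (P : Program) (c : Config) : Option Config := P[c.pc]?.bind (exec c)

/-- The initial configuration: all registers are zero. -/
def init (input : List ℕ) : Config := ⟨0, fun _ => 0, input, []⟩

/-- `Run P t c d`: the program leads from `c` to `d` in exactly `t` steps. -/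
def Run (P : Program) : ℕ → Config → Config → Prop
  | 0, c, d => c = d
  | t + 1, c, d => ∃ c', step P c = some c' ∧ Run P t c' d

/-- On the given input the program stops after at most `T` steps with the given output, and during
the computation no register ever holds a number larger than `B`. -/
def ComputesWithin (P : Program) (input output : List ℕ) (T B : ℕ) : Prop :=
  (∃ t ≤ T, ∃ d : Config, Run P t (init input) d ∧ step P d = none ∧ d.output = output) ∧
  ∀ (t : ℕ) (c : Config), Run P t (init input) c → ∀ r : ℕ, c.mem r ≤ B

end RAM

/-! The algebra takes place in the trace monoid, that is, words modulo exchange of neighbouring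
letters with distinct commuting generators. The group acts on traces of reduced words, and the orbit
of the empty trace shows that two reduced words for the same element are trace equivalent
(`swap_of_elt_eq`).

If g commutes with [w] and w is cyclically reduced, a high power of [w] absorbs all cancellation
against g. So g may be replaced by an element [x] for which wx and xw are trace equivalent
(`exists_swap_comm`). Projecting to two adjacent generators gives commuting words in a free monoid,
so letters of x outside the support of w commute with all of w (`not_adj_of_swap_comm`). Filtering
by the support of a factor reduces the rest to a single non-split factor. When that factor is
rotated to begin with its smallest generator, both concatenations are in lexicographic normal form.
Trace equivalence then becomes equality of words (`LexNormal.append_comm`), and commuting words are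
powers of a common word. Hence the filtered part of x represents a power of the root
(`elt_mem_zpowers_of_swap_comm`, `IsNonSplitDecomposition.mem_of_commute`). Torsion-freeness,
together with the endomorphism killing the support of w, makes the cyclic group of the root the
largest cyclic one through [w] (`mem_zpowers_root`).

The algorithm finds the root of each factor by the Knuth-Morris-Pratt border table. If k is the
longest proper border of a word of length n, then n - k is its smallest period, and the root has
length n - k or n according to whether n - k divides n (`isWordRoot_take`). The length of the
current border is the potential that makes reading linear (`compare_loop`, `read_loop`), and
divisibility is tested by repeated subtraction (`divide_loop`). Letters are flagged as they are
read. A final piece of code without loops, fixed by the graph, adds up the flags of the neighbours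
of each vertex (`central_run`). -/

namespace RAAG

variable {N : ℕ} {Γ : SimpleGraph (Fin N)}

/-! ### Commutation of letters and trace equivalence of words -/

/-- The inverse letter. -/
def bar (l : Fin N × Bool) : Fin N × Bool := (l.1, !l.2)

@[simp] theorem bar_fst (l : Fin N × Bool) : (bar l).1 = l.1 := rfl

@[simp] theorem bar_bar (l : Fin N × Bool) : bar (bar l) = l := by
  simp [bar]

theorem bar_ne (l : Fin N × Bool) : bar l ≠ l := by
  rcases l with ⟨a, _ | _⟩ <;> simp [bar]

/-- Letters with distinct commuting generators. -/
def Indep (Γ : SimpleGraph (Fin N)) (l m : Fin N × Bool) : Prop :=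
  l.1 ≠ m.1 ∧ ¬ Γ.Adj l.1 m.1

theorem Indep.symm {l m : Fin N × Bool} (h : Indep Γ l m) : Indep Γ m l :=
  ⟨h.1.symm, fun h' => h.2 h'.symm⟩

theorem not_indep_self (l : Fin N × Bool) : ¬ Indep Γ l l := fun h => h.1 rfl

/-- Exchange of two consecutive independent letters. -/
def SwapStep (Γ : SimpleGraph (Fin N)) (u v : Word N) : Prop :=
  ∃ p q l m, Indep Γ l m ∧ u = p ++ l :: m :: q ∧ v = p ++ m :: l :: q

/-- Trace equivalence: the words differ by exchanges of consecutive independent letters. -/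
def Swap (Γ : SimpleGraph (Fin N)) : Word N → Word N → Prop := Relation.ReflTransGen (SwapStep Γ)

theorem SwapStep.symm {u v : Word N} (h : SwapStep Γ u v) : SwapStep Γ v u := by
  obtain ⟨p, q, l, m, h, rfl, rfl⟩ := h
  exact ⟨p, q, m, l, h.symm, rfl, rfl⟩

theorem Swap.refl (u : Word N) : Swap Γ u u := Relation.ReflTransGen.refl

theorem Swap.trans {u v w : Word N} (h : Swap Γ u v) (h' : Swap Γ v w) : Swap Γ u w :=
  Relation.ReflTransGen.trans h h'

theorem Swap.symm {u v : Word N} (h : Swap Γ u v) : Swap Γ v u := by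
  induction h with
  | refl => exact .refl _
  | tail _ h ih => exact .trans (.single h.symm) ih

/-- An invariant of exchanges is an invariant of trace equivalence. -/
theorem Swap.invariant {α : Sort*} (f : Word N → α)
    (hf : ∀ (p q : Word N) l m, Indep Γ l m → f (p ++ l :: m :: q) = f (p ++ m :: l :: q))
    {u v : Word N} (h : Swap Γ u v) : f u = f v := by
  induction h with
  | refl => rfl
  | tail _ h ih =>
    obtain ⟨p, q, l, m, h, rfl, rfl⟩ := h
    exact ih.trans (hf p q l m h)

theorem Swap.map (f : Word N → Word N)
    (hf : ∀ (p q : Word N) l m, Indep Γ l m → Swap Γ (f (p ++ l :: m :: q)) (f (p ++ m :: l :: q)))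
    {u v : Word N} (h : Swap Γ u v) : Swap Γ (f u) (f v) := by
  induction h with
  | refl => exact .refl _
  | tail _ h ih =>
    obtain ⟨p, q, l, m, h, rfl, rfl⟩ := h
    exact ih.trans (hf p q l m h)

theorem Swap.of_indep {l m : Fin N × Bool} (h : Indep Γ l m) (p q : Word N) :
    Swap Γ (p ++ l :: m :: q) (p ++ m :: l :: q) := .single ⟨p, q, l, m, h, rfl, rfl⟩

theorem Swap.append_left {u v : Word N} (p : Word N) (h : Swap Γ u v) :
    Swap Γ (p ++ u) (p ++ v) := by
  refine h.map _ fun p' q l m h => ?_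
  simpa using Swap.of_indep h (p ++ p') q

theorem Swap.append_right {u v : Word N} (p : Word N) (h : Swap Γ u v) :
    Swap Γ (u ++ p) (v ++ p) := by
  refine h.map (· ++ p) fun p' q l m h => ?_
  simpa using Swap.of_indep h p' (q ++ p)

theorem Swap.append {u v u' v' : Word N} (h : Swap Γ u v) (h' : Swap Γ u' v') :
    Swap Γ (u ++ u') (v ++ v') := (h.append_right _).trans (h'.append_left _)

theorem Swap.cons {u v : Word N} (l : Fin N × Bool) (h : Swap Γ u v) :
    Swap Γ (l :: u) (l :: v) := h.append_left [l]

theorem Swap.perm {u v : Word N} (h : Swap Γ u v) : u.Perm v := by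
  induction h with
  | refl => exact .refl _
  | tail _ h ih =>
    obtain ⟨p, q, l, m, h, rfl, rfl⟩ := h
    exact ih.trans ((List.Perm.swap _ _ _).append_left p)

theorem Swap.filter {u v : Word N} (f : Fin N × Bool → Bool) (h : Swap Γ u v) :
    Swap Γ (u.filter f) (v.filter f) := by
  refine h.map _ fun p q l m h => ?_
  simp only [List.filter_append, List.filter_cons]
  split_ifs
  · exact Swap.of_indep h _ _
  all_goals exact .refl _

/-- Independent letters are distinct, so at most one letter of an exchanged pair is the erased one.
This yields left cancellation for traces. -/
theorem Swap.erase {u v : Word N} (b : Fin N × Bool) (h : Swap Γ u v) :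
    Swap Γ (u.erase b) (v.erase b) := by
  refine h.map (fun u => u.erase b) fun p q l m h => ?_
  simp only [List.erase_append]
  split_ifs
  · exact Swap.of_indep h _ _
  · have hlm : l ≠ m := fun e => h.1 (by rw [e])
    simp only [List.erase_cons, beq_iff_eq]
    split_ifs with h1 h2
    · exact absurd (h1.trans h2.symm) hlm
    · exact .refl _
    · exact .refl _
    · exact Swap.of_indep h _ _

/-- A letter may be moved across letters that are independent of it. -/
theorem swap_move (b : Fin N × Bool) (p : Word N) (h : ∀ x ∈ p, Indep Γ x b) :
    Swap Γ (p ++ [b]) (b :: p) := by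
  induction p with
  | nil => exact .refl _
  | cons x p ih =>
    have h1 : Swap Γ (x :: p ++ [b]) (x :: b :: p) := (ih fun y hy => h y (by simp [hy])).cons x
    exact h1.trans (Swap.of_indep (h x (by simp)) [] p)

/-! ### First letters -/

/-- The letter `b` is a first letter of some word trace equivalent to the given one. -/
def First (Γ : SimpleGraph (Fin N)) (b : Fin N × Bool) : Word N → Prop
  | [] => False
  | h :: t => h = b ∨ (Indep Γ h b ∧ First Γ b t)

@[simp] theorem first_nil (b : Fin N × Bool) : ¬ First Γ b [] := id

theorem first_cons {b h : Fin N × Bool} {t : Word N} :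
    First Γ b (h :: t) ↔ h = b ∨ (Indep Γ h b ∧ First Γ b t) := Iff.rfl

theorem first_cons_of_indep {b h : Fin N × Bool} {t : Word N} (hb : Indep Γ h b) :
    First Γ b (h :: t) ↔ First Γ b t := by
  rw [first_cons]
  constructor
  · rintro (rfl | h)
    · exact absurd hb (not_indep_self _)
    · exact h.2
  · exact fun h => .inr ⟨hb, h⟩

theorem first_iff {b : Fin N × Bool} {u : Word N} :
    First Γ b u ↔ ∃ p q, u = p ++ b :: q ∧ ∀ x ∈ p, Indep Γ x b := by
  induction u with
  | nil => simp
  | cons h t ih =>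
    rw [first_cons, ih]
    constructor
    · rintro (rfl | ⟨hb, p, q, rfl, hp⟩)
      · exact ⟨[], t, rfl, by simp⟩
      · exact ⟨h :: p, q, rfl, List.forall_mem_cons.2 ⟨hb, hp⟩⟩
    · rintro ⟨p, q, e, hp⟩
      cases p with
      | nil => left; simpa using (List.cons.inj e).1
      | cons x p =>
        obtain ⟨rfl, rfl⟩ := List.cons.inj e
        exact .inr ⟨hp h (by simp), p, q, rfl, fun y hy => hp y (by simp [hy])⟩

theorem First.mem {b : Fin N × Bool} {u : Word N} (h : First Γ b u) : b ∈ u := by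
  obtain ⟨p, q, rfl, -⟩ := first_iff.1 h
  simp

theorem First.append {b : Fin N × Bool} {u : Word N} (h : First Γ b u) (v : Word N) :
    First Γ b (u ++ v) := by
  obtain ⟨p, q, rfl, hp⟩ := first_iff.1 h
  exact first_iff.2 ⟨p, q ++ v, by simp, hp⟩

/-- A first letter of `u ++ v` whose generator occurs in `u` is a first letter of `u`. -/
theorem First.of_append {b : Fin N × Bool} {u v : Word N} (h : First Γ b (u ++ v))
    (hb : ∃ x ∈ u, x.1 = b.1) : First Γ b u := by
  induction u with
  | nil => simp at hb
  | cons x u ih =>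
    rcases h with rfl | ⟨hx, h⟩
    · exact .inl rfl
    · refine .inr ⟨hx, ih h ?_⟩
      obtain ⟨y, hy, e⟩ := hb
      rcases List.mem_cons.1 hy with rfl | hy
      · exact absurd e hx.1
      · exact ⟨y, hy, e⟩

theorem Swap.first_iff {u v : Word N} (b : Fin N × Bool) (h : Swap Γ u v) :
    First Γ b u ↔ First Γ b v := by
  refine iff_of_eq (h.invariant (First Γ b) fun p q l m h => ?_)
  induction p with
  | nil =>
    simp only [List.nil_append, eq_iff_iff, first_cons]
    constructor
    · rintro (rfl | ⟨h1, rfl | ⟨h2, h3⟩⟩)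
      · exact .inr ⟨h.symm, .inl rfl⟩
      · exact .inl rfl
      · exact .inr ⟨h2, .inr ⟨h1, h3⟩⟩
    · rintro (rfl | ⟨h1, rfl | ⟨h2, h3⟩⟩)
      · exact .inr ⟨h, .inl rfl⟩
      · exact .inl rfl
      · exact .inr ⟨h2, .inr ⟨h1, h3⟩⟩
  | cons x p ih =>
    simp only [List.cons_append, eq_iff_iff, first_cons] at ih ⊢
    rw [ih]

/-- Only letters independent of b precede the witness, and none of them equals b. The occurrence
moved to the front is therefore the one that `erase` removes. -/
theorem First.swap_cons_erase {b : Fin N × Bool} {u : Word N} (h : First Γ b u) :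
    Swap Γ u (b :: u.erase b) := by
  induction u with
  | nil => exact h.elim
  | cons x u ih =>
    rcases h with rfl | ⟨hx, h⟩
    · simpa using Swap.refl _
    · have hne : x ≠ b := fun e => hx.1 (by rw [e])
      rw [List.erase_cons_tail (by simpa using hne)]
      exact ((ih h).cons x).trans (Swap.of_indep hx [] _)

theorem first_erase_of_indep {b c : Fin N × Bool} {u : Word N} (h : Indep Γ b c) :
    First Γ b (u.erase c) ↔ First Γ b u := by
  induction u with
  | nil => rfl
  | cons x u ih =>
    by_cases hx : x = c
    · subst hx
      rw [List.erase_cons_head, first_cons_of_indep h.symm]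
    · rw [List.erase_cons_tail (by simpa using hx), first_cons, first_cons, ih]

theorem Swap.of_cons {b : Fin N × Bool} {u v : Word N} (h : Swap Γ (b :: u) (b :: v)) :
    Swap Γ u v := by
  simpa using h.erase b

/-! ### Reduced words -/

theorem reduced_nil : Reduced Γ [] := by
  rintro ⟨u, x, v, a, ε, h, -⟩
  simp at h

/-- A word that is not reduced contains a pair of mutually inverse letters all letters between
which are independent of them. -/
theorem not_reduced_iff {w : Word N} :
    ¬ Reduced Γ w ↔ ∃ (u x v : Word N) (l : Fin N × Bool),
      w = u ++ l :: x ++ bar l :: v ∧ ∀ y ∈ x, Indep Γ y l := by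
  constructor
  · intro h
    have h : ∃ n, ∃ (u x v : Word N) (l : Fin N × Bool), x.length = n ∧
        w = u ++ l :: x ++ bar l :: v ∧ ∀ y ∈ x, ¬ Γ.Adj l.1 y.1 := by
      rw [Reduced, not_not] at h
      obtain ⟨u, x, v, a, ε, rfl, h⟩ := h
      exact ⟨_, u, x, v, (a, ε), rfl, by simp [bar], h⟩
    classical
    -- Take a cancelling pair with the shortest word x in between. A letter of x with the same
    -- generator would be one end of a closer cancelling pair.
    obtain ⟨u, x, v, l, hn, hw, hx⟩ := Nat.find_spec h
    refine ⟨u, x, v, l, hw, fun y hy => ⟨fun e => ?_, fun h => hx y hy h.symm⟩⟩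
    obtain ⟨x₁, x₂, rfl⟩ := List.append_of_mem hy
    by_cases hyl : y = l
    · subst hyl
      refine Nat.find_min h (m := x₂.length) ?_ ⟨u ++ y :: x₁, x₂, v, y, rfl, by simp [hw], ?_⟩
      · rw [← hn]; simp; omega
      · exact fun z hz => hx z (by simp [hz])
    · have hyl : y = bar l := by
        rcases y with ⟨a, ε⟩; rcases l with ⟨b, δ⟩
        simp only [Prod.mk.injEq, not_and] at e hyl
        subst e
        have := hyl rfl
        cases ε <;> cases δ <;> simp_all [bar]
      refine Nat.find_min h (m := x₁.length) ?_
        ⟨u, x₁, x₂ ++ bar l :: v, l, rfl, by simp [hw, hyl], ?_⟩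
      · rw [← hn]; simp
      · exact fun z hz => hx z (by simp [hz])
  · rintro ⟨u, x, v, l, rfl, hx⟩ h
    exact h ⟨u, x, v, l.1, l.2, by simp [bar], fun y hy h => (hx y hy).2 h.symm⟩

/-- This recursive form of reducedness is the one used in inductions: a new cancellation must
involve the new head, and its partner can be brought to the front of the tail. -/
theorem reduced_cons {l : Fin N × Bool} {u : Word N} :
    Reduced Γ (l :: u) ↔ Reduced Γ u ∧ ¬ First Γ (bar l) u := by
  rw [← not_iff_not, not_reduced_iff, not_and_or, not_not, not_reduced_iff, first_iff]
  constructor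
  · rintro ⟨p, x, v, m, e, hx⟩
    cases p with
    | nil =>
      simp only [List.nil_append, List.cons_append, List.cons.injEq] at e
      obtain ⟨rfl, rfl⟩ := e
      exact .inr ⟨x, v, rfl, hx⟩
    | cons y p =>
      simp only [List.cons_append, List.cons.injEq] at e
      exact .inl ⟨p, x, v, m, by simpa using e.2, hx⟩
  · rintro (⟨p, x, v, m, rfl, hx⟩ | ⟨p, q, rfl, hp⟩)
    · exact ⟨l :: p, x, v, m, by simp, hx⟩
    · exact ⟨[], p, q, l, by simp, hp⟩

theorem Swap.reduced_iff {u v : Word N} (h : Swap Γ u v) : Reduced Γ u ↔ Reduced Γ v := by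
  refine iff_of_eq (h.invariant (Reduced Γ) fun p q l m h => ?_)
  induction p with
  | nil =>
    simp only [List.nil_append, reduced_cons, eq_iff_iff]
    rw [first_cons_of_indep (b := bar l) h.symm, first_cons_of_indep (b := bar m) h]
    tauto
  | cons x p ih =>
    simp only [List.cons_append, reduced_cons, eq_iff_iff] at ih ⊢
    rw [ih, Swap.first_iff (bar x) (Swap.of_indep h p q)]

theorem Reduced.of_append_left {u v : Word N} (h : Reduced Γ (u ++ v)) : Reduced Γ u := by
  rintro ⟨p, x, q, a, ε, rfl, hx⟩
  exact h ⟨p, x, q ++ v, a, ε, by simp, hx⟩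

theorem Reduced.of_append_right {u v : Word N} (h : Reduced Γ (u ++ v)) : Reduced Γ v := by
  rintro ⟨p, x, q, a, ε, rfl, hx⟩
  exact h ⟨u ++ p, x, q, a, ε, by simp, hx⟩

/-! ### Words as group elements -/

theorem elt_nil : elt Γ [] = 1 := by
  rw [elt, ← FreeGroup.one_eq_mk, map_one]

theorem elt_append (u v : Word N) : elt Γ (u ++ v) = elt Γ u * elt Γ v := by
  rw [elt, ← FreeGroup.mul_mk, map_mul]; rfl

theorem elt_cons (l : Fin N × Bool) (u : Word N) : elt Γ (l :: u) = elt Γ [l] * elt Γ u :=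
  elt_append [l] u

theorem elt_gen (a : Fin N) : elt Γ [(a, true)] = gen Γ a := rfl

theorem elt_gen_inv (a : Fin N) : elt Γ [(a, false)] = (gen Γ a)⁻¹ := by
  rw [gen, PresentedGroup.of, ← map_inv, FreeGroup.of, FreeGroup.inv_mk]; rfl

theorem elt_bar (l : Fin N × Bool) : elt Γ [bar l] = (elt Γ [l])⁻¹ := by
  rcases l with ⟨a, _ | _⟩ <;> simp [bar, elt_gen, elt_gen_inv]

theorem gen_commute {a b : Fin N} (h : ¬ Γ.Adj a b) : Commute (gen Γ a) (gen Γ b) := by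
  have h1 : gen Γ a * gen Γ b * (gen Γ a)⁻¹ * (gen Γ b)⁻¹ = 1 := by
    have := PresentedGroup.one_of_mem (rels := relators Γ) ⟨a, b, h, rfl⟩
    simpa [gen, PresentedGroup.of] using this
  rw [mul_inv_eq_one, mul_inv_eq_iff_eq_mul] at h1
  exact h1

theorem elt_letter_commute {l m : Fin N × Bool} (h : ¬ Γ.Adj l.1 m.1) :
    Commute (elt Γ [l]) (elt Γ [m]) := by
  have := gen_commute h
  rcases l with ⟨a, _ | _⟩ <;> rcases m with ⟨b, _ | _⟩ <;>
    simpa [elt_gen, elt_gen_inv] using this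

theorem elt_commute {u v : Word N} (h : ∀ l ∈ u, ∀ m ∈ v, ¬ Γ.Adj l.1 m.1) :
    Commute (elt Γ u) (elt Γ v) := by
  induction u with
  | nil => rw [elt_nil]; exact Commute.one_left _
  | cons l u ih =>
    rw [elt_cons]
    refine Commute.mul_left ?_ (ih fun l hl => h l (by simp [hl]))
    replace h : ∀ m ∈ v, ¬ Γ.Adj l.1 m.1 := h l (by simp)
    clear ih
    induction v with
    | nil => rw [elt_nil]; exact Commute.one_right _
    | cons m v ih =>
      rw [elt_cons]
      exact Commute.mul_right (elt_letter_commute (h m (by simp)))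
        (ih fun m hm => h m (by simp [hm]))

theorem Swap.elt_eq {u v : Word N} (h : Swap Γ u v) : elt Γ u = elt Γ v := by
  refine h.invariant (elt Γ) fun p q l m h => ?_
  rw [elt_append, elt_append, elt_cons l (m :: q), elt_cons m q, elt_cons m (l :: q), elt_cons l q,
    ← mul_assoc (elt Γ [l]), (elt_letter_commute h.2).eq, mul_assoc]

theorem elt_surjective (g : RAAGroup Γ) : ∃ u, elt Γ u = g := by
  obtain ⟨f, rfl⟩ := PresentedGroup.mk_surjective (relators Γ) g
  exact ⟨f.toWord, by rw [elt, FreeGroup.mk_toWord]⟩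

/-! ### The word problem -/

open Classical in
/-- The reduced word for `[l][u]` obtained from a reduced word `u`. -/
noncomputable def act (Γ : SimpleGraph (Fin N)) (l : Fin N × Bool) (u : Word N) : Word N :=
  if First Γ (bar l) u then u.erase (bar l) else l :: u

theorem act_of_first {l : Fin N × Bool} {u : Word N} (h : First Γ (bar l) u) :
    act Γ l u = u.erase (bar l) := if_pos h

theorem act_of_not_first {l : Fin N × Bool} {u : Word N} (h : ¬ First Γ (bar l) u) :
    act Γ l u = l :: u := if_neg h

theorem Swap.act {u v : Word N} (l : Fin N × Bool) (h : Swap Γ u v) :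
    Swap Γ (act Γ l u) (act Γ l v) := by
  by_cases hu : First Γ (bar l) u
  · rw [act_of_first hu, act_of_first ((h.first_iff _).1 hu)]
    exact h.erase _
  · rw [act_of_not_first hu, act_of_not_first (mt (h.first_iff _).2 hu)]
    exact h.cons l

theorem Reduced.act {u : Word N} (l : Fin N × Bool) (h : Reduced Γ u) : Reduced Γ (act Γ l u) := by
  by_cases hu : First Γ (bar l) u
  · rw [act_of_first hu]
    exact (reduced_cons.1 (hu.swap_cons_erase.reduced_iff.1 h)).1
  · rw [act_of_not_first hu]
    exact reduced_cons.2 ⟨h, hu⟩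

theorem elt_act (l : Fin N × Bool) (u : Word N) : elt Γ (act Γ l u) = elt Γ [l] * elt Γ u := by
  by_cases hu : First Γ (bar l) u
  · rw [act_of_first hu, hu.swap_cons_erase.elt_eq, elt_cons (bar l), elt_bar, mul_inv_cancel_left]
  · rw [act_of_not_first hu, elt_cons]

/-- Reducedness is essential: after the inverse of l has been cancelled from u, no letter l can come
to the front, so the inverse letter is put back and cancels nothing further. -/
theorem act_bar_act {u : Word N} (l : Fin N × Bool) (h : Reduced Γ u) :
    Swap Γ (act Γ (bar l) (act Γ l u)) u := by
  by_cases hu : First Γ (bar l) u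
  · have h1 := (reduced_cons.1 (hu.swap_cons_erase.reduced_iff.1 h)).2
    rw [act_of_first hu, act_of_not_first h1]
    exact hu.swap_cons_erase.symm
  · rw [act_of_not_first hu, act_of_first (first_cons.2 (.inl (by simp))), bar_bar,
      List.erase_cons_head]
    exact .refl _

/-- Cancellation of one letter does not affect whether the other can be cancelled. An actual
exchange is needed only if neither cancels. -/
theorem act_act_comm {l m : Fin N × Bool} (h : Indep Γ l m) (u : Word N) :
    Swap Γ (act Γ l (act Γ m u)) (act Γ m (act Γ l u)) := by
  have hlm : l ≠ bar m := fun e => h.1 (by rw [e]; rfl)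
  have hml : m ≠ bar l := fun e => h.1 (by rw [e]; rfl)
  by_cases hl : First Γ (bar l) u <;> by_cases hm : First Γ (bar m) u
  · have hl' : First Γ (bar l) (u.erase (bar m)) :=
      (first_erase_of_indep (b := bar l) (c := bar m) h).2 hl
    have hm' : First Γ (bar m) (u.erase (bar l)) :=
      (first_erase_of_indep (b := bar m) (c := bar l) h.symm).2 hm
    rw [act_of_first hl, act_of_first hm, act_of_first hl', act_of_first hm', List.erase_comm]
    exact .refl _
  · have hl' : First Γ (bar l) (m :: u) := (first_cons_of_indep (b := bar l) h.symm).2 hl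
    have hm' : ¬ First Γ (bar m) (u.erase (bar l)) :=
      mt (first_erase_of_indep (b := bar m) (c := bar l) h.symm).1 hm
    rw [act_of_first hl, act_of_not_first hm, act_of_first hl', act_of_not_first hm',
      List.erase_cons_tail (by simpa using hml)]
    exact .refl _
  · have hl' : ¬ First Γ (bar l) (u.erase (bar m)) :=
      mt (first_erase_of_indep (b := bar l) (c := bar m) h).1 hl
    have hm' : First Γ (bar m) (l :: u) := (first_cons_of_indep (b := bar m) h).2 hm
    rw [act_of_not_first hl, act_of_first hm, act_of_not_first hl', act_of_first hm',
      List.erase_cons_tail (by simpa using hlm)]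
    exact .refl _
  · have hl' : ¬ First Γ (bar l) (m :: u) := mt (first_cons_of_indep (b := bar l) h.symm).1 hl
    have hm' : ¬ First Γ (bar m) (l :: u) := mt (first_cons_of_indep (b := bar m) h).1 hm
    rw [act_of_not_first hl, act_of_not_first hm, act_of_not_first hl', act_of_not_first hm']
    exact Swap.of_indep h [] u

/-! ### The group action on traces of reduced words -/

/-- Trace equivalence of reduced words. -/
def reducedSetoid (Γ : SimpleGraph (Fin N)) : Setoid {u : Word N // Reduced Γ u} where
  r u v := Swap Γ u.1 v.1
  iseqv := ⟨fun _ => .refl _, fun h => h.symm, fun h h' => h.trans h'⟩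

/-- Trace equivalence classes of reduced words. -/
abbrev ReducedTrace (Γ : SimpleGraph (Fin N)) : Type := Quotient (reducedSetoid Γ)

/-- The action of a letter on classes of reduced words. -/
noncomputable def traceAct (Γ : SimpleGraph (Fin N)) (l : Fin N × Bool) :
    ReducedTrace Γ → ReducedTrace Γ :=
  Quotient.map (sa := reducedSetoid Γ) (sb := reducedSetoid Γ)
    (fun u => ⟨act Γ l u.1, u.2.act l⟩) fun _ _ h => Swap.act l h

theorem traceAct_bar (l : Fin N × Bool) (t : ReducedTrace Γ) :
    traceAct Γ (bar l) (traceAct Γ l t) = t := by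
  induction t using Quotient.inductionOn with
  | h u => exact Quotient.sound (act_bar_act l u.2)

/-- The action of a generator on classes of reduced words. -/
noncomputable def genPerm (Γ : SimpleGraph (Fin N)) (a : Fin N) : Equiv.Perm (ReducedTrace Γ) where
  toFun := traceAct Γ (a, true)
  invFun := traceAct Γ (a, false)
  left_inv := traceAct_bar (a, true)
  right_inv := traceAct_bar (a, false)

theorem genPerm_relators (r : FreeGroup (Fin N)) (hr : r ∈ relators Γ) :
    FreeGroup.lift (genPerm Γ) r = 1 := by
  obtain ⟨a, b, h, rfl⟩ := hr
  simp only [map_mul, map_inv, FreeGroup.lift_apply_of]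
  rw [mul_inv_eq_one, mul_inv_eq_iff_eq_mul]
  -- A graph has no loops, so the relators include the trivial case of equal generators, to which
  -- independence does not apply.
  by_cases hab : a = b
  · rw [hab]
  · ext t
    induction t using Quotient.inductionOn with
    | h u => exact Quotient.sound (act_act_comm (l := (a, true)) (m := (b, true)) ⟨hab, h⟩ u.1)

/-- The action of the group on classes of reduced words. -/
noncomputable def groupAct (Γ : SimpleGraph (Fin N)) :
    RAAGroup Γ →* Equiv.Perm (ReducedTrace Γ) :=
  PresentedGroup.toGroup (f := genPerm Γ) genPerm_relators

theorem groupAct_letter (l : Fin N × Bool) (t : ReducedTrace Γ) :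
    groupAct Γ (elt Γ [l]) t = traceAct Γ l t := by
  have h (a) : groupAct Γ (gen Γ a) = genPerm Γ a := PresentedGroup.toGroup.of _
  rcases l with ⟨a, _ | _⟩
  · rw [elt_gen_inv, map_inv, h]; rfl
  · rw [elt_gen, h]; rfl

/-- Building up a reduced word letter by letter never cancels, so the group element determines the
trace of any reduced word for it. -/
theorem groupAct_reduced {u : Word N} (h : Reduced Γ u) :
    groupAct Γ (elt Γ u) (Quotient.mk (reducedSetoid Γ) ⟨[], reduced_nil⟩) =
      Quotient.mk (reducedSetoid Γ) ⟨u, h⟩ := by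
  induction u with
  | nil => rw [elt_nil, map_one]; rfl
  | cons l u ih =>
    have h' := reduced_cons.1 h
    rw [elt_cons, map_mul, Equiv.Perm.mul_apply, ih h'.1, groupAct_letter]
    refine congrArg (Quotient.mk (reducedSetoid Γ)) (Subtype.ext ?_)
    exact act_of_not_first h'.2

/-- Reduced words that represent the same element are trace equivalent. -/
theorem swap_of_elt_eq {u v : Word N} (hu : Reduced Γ u) (hv : Reduced Γ v)
    (h : elt Γ u = elt Γ v) : Swap Γ u v := by
  have := groupAct_reduced hu
  rw [h, groupAct_reduced hv] at this
  exact (Quotient.exact this).symm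

/-- A reduced word for the element represented by a word. -/
noncomputable def reduce (Γ : SimpleGraph (Fin N)) : Word N → Word N
  | [] => []
  | l :: u => act Γ l (reduce Γ u)

theorem reduced_reduce (u : Word N) : Reduced Γ (reduce Γ u) := by
  induction u with
  | nil => exact reduced_nil
  | cons l u ih => exact ih.act l

theorem elt_reduce (u : Word N) : elt Γ (reduce Γ u) = elt Γ u := by
  induction u with
  | nil => rfl
  | cons l u ih => rw [reduce, elt_act, ih, ← elt_cons]

theorem exists_reduced (g : RAAGroup Γ) : ∃ u, Reduced Γ u ∧ elt Γ u = g := by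
  obtain ⟨u, rfl⟩ := elt_surjective g
  exact ⟨_, reduced_reduce u, elt_reduce u⟩

/-- A cancellation makes the result strictly shorter than the input, so equal lengths mean that
nothing was cancelled. -/
theorem reduce_of_length (u : Word N) :
    (reduce Γ u).length ≤ u.length ∧ (u.length ≤ (reduce Γ u).length → reduce Γ u = u) := by
  induction u with
  | nil => exact ⟨le_rfl, fun _ => rfl⟩
  | cons l u ih =>
    rw [reduce]
    by_cases h : First Γ (bar l) (reduce Γ u)
    · rw [act_of_first h, List.length_erase_of_mem h.mem, List.length_cons]
      exact ⟨by omega, fun h' => by omega⟩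
    · rw [act_of_not_first h]
      simp only [List.length_cons, Nat.add_le_add_iff_right]
      exact ⟨ih.1, fun h => by rw [ih.2 h]⟩

/-- A shortest word is reduced. -/
theorem reduced_of_length_le {u v : Word N} (hu : Reduced Γ u) (h : elt Γ v = elt Γ u)
    (hl : v.length ≤ u.length) : Reduced Γ v := by
  have h1 := (swap_of_elt_eq hu (reduced_reduce v) (by rw [elt_reduce, h])).perm.length_eq
  rw [← (reduce_of_length v).2 (h1 ▸ hl)]
  exact reduced_reduce v

theorem elt_ne_one {u : Word N} (hu : Reduced Γ u) (h : u ≠ []) : elt Γ u ≠ 1 := by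
  intro h1
  have := (swap_of_elt_eq hu reduced_nil (h1.trans elt_nil.symm)).perm
  exact h (by simpa using this)

/-- For adjacent a and b, the words ab and ba are reduced and have different first letters, so they
are not trace equivalent. -/
theorem gen_commute_iff {a b : Fin N} : Commute (gen Γ a) (gen Γ b) ↔ ¬ Γ.Adj a b := by
  refine ⟨fun h hab => ?_, gen_commute⟩
  have hr : ∀ a b : Fin N, a ≠ b → Reduced Γ [(a, true), (b, true)] := by
    intro a b hab
    simp [reduced_cons, first_cons, reduced_nil, bar]
  have h1 : Swap Γ [(a, true), (b, true)] [(b, true), (a, true)] := by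
    refine swap_of_elt_eq (hr _ _ hab.ne) (hr _ _ hab.ne.symm) ?_
    rw [elt_cons, elt_cons (b, true)]
    exact h
  have h2 := (h1.first_iff (b, true)).2 (.inl rfl)
  simp [first_cons, hab.ne, Indep, hab] at h2

/-! ### Powers of words -/

theorem wordPow_zero (z : Word N) : wordPow z 0 = [] := rfl

theorem wordPow_succ (z : Word N) (r : ℕ) : wordPow z (r + 1) = z ++ wordPow z r := by
  simp [wordPow, List.replicate_succ]

theorem wordPow_one (z : Word N) : wordPow z 1 = z := by simp [wordPow]

theorem wordPow_add (z : Word N) (r s : ℕ) : wordPow z (r + s) = wordPow z r ++ wordPow z s := by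
  rw [wordPow, List.replicate_add, List.flatten_append]; rfl

theorem wordPow_nil (r : ℕ) : wordPow ([] : Word N) r = [] := by
  induction r with
  | zero => rfl
  | succ r ih => rw [wordPow_succ, ih]; rfl

theorem wordPow_succ' (z : Word N) (r : ℕ) : wordPow z (r + 1) = wordPow z r ++ z := by
  rw [wordPow_add, wordPow_one]

theorem wordPow_mul (z : Word N) (r s : ℕ) : wordPow z (r * s) = wordPow (wordPow z r) s := by
  induction s with
  | zero => rfl
  | succ s ih => rw [Nat.mul_succ, wordPow_add, ih, wordPow_succ']

theorem length_wordPow (z : Word N) (r : ℕ) : (wordPow z r).length = r * z.length := by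
  simp [wordPow]

theorem mem_of_mem_wordPow {z : Word N} {r : ℕ} {l : Fin N × Bool} (h : l ∈ wordPow z r) :
    l ∈ z := by
  simp only [wordPow, List.mem_flatten, List.mem_replicate] at h
  obtain ⟨_, ⟨-, rfl⟩, h⟩ := h
  exact h

theorem mem_wordPow {z : Word N} {r : ℕ} (hr : r ≠ 0) {l : Fin N × Bool} :
    l ∈ wordPow z r ↔ l ∈ z := by
  refine ⟨mem_of_mem_wordPow, fun h => ?_⟩
  obtain ⟨r, rfl⟩ := Nat.exists_eq_succ_of_ne_zero hr
  rw [Nat.succ_eq_add_one, wordPow_succ]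
  exact List.mem_append_left _ h

theorem elt_wordPow (z : Word N) (r : ℕ) : elt Γ (wordPow z r) = elt Γ z ^ r := by
  induction r with
  | zero => rw [wordPow_zero, elt_nil, pow_zero]
  | succ r ih => rw [wordPow_succ, elt_append, ih, pow_succ']

theorem append_wordPow_append (u v : Word N) (n : ℕ) :
    v ++ wordPow (u ++ v) n ++ u = wordPow (v ++ u) (n + 1) := by
  induction n with
  | zero => simp [wordPow_zero, wordPow_one]
  | succ n ih => rw [wordPow_succ _ (n + 1), ← ih, wordPow_succ]; simp

/-- Rotating a power by one letter rotates its base by one letter. -/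
theorem exists_wordPow_rotate {u c : Word N} {i : ℕ} (h : u = wordPow c i) (k : ℕ) :
    ∃ d, u.rotate k = wordPow d i := by
  induction k with
  | zero => exact ⟨c, by rw [List.rotate_zero, h]⟩
  | succ k ih =>
    obtain ⟨d, hd⟩ := ih
    rw [← List.rotate_rotate, hd]
    rcases i with _ | i
    · exact ⟨[], by simp [wordPow]⟩
    · rcases d with _ | ⟨x, d⟩
      · exact ⟨[], by simp [wordPow_nil]⟩
      · refine ⟨d ++ [x], ?_⟩
        rw [← append_wordPow_append, wordPow_succ]
        simp

theorem exists_wordPow_of_isRotated {u v c : Word N} {i : ℕ} (h : u = wordPow c i) (hv : u ~r v) :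
    ∃ d, v = wordPow d i := by
  obtain ⟨k, rfl⟩ := hv
  exact exists_wordPow_rotate h k

/-- Commuting words are powers of a common word. -/
theorem exists_wordPow_of_append_comm {u v : Word N} (h : u ++ v = v ++ u) :
    ∃ c i j, u = wordPow c i ∧ v = wordPow c j := by
  induction hn : u.length + v.length using Nat.strong_induction_on generalizing u v with
  | _ n ih =>
    rcases eq_or_ne u [] with rfl | hu
    · exact ⟨v, 0, 1, rfl, (wordPow_one v).symm⟩
    rcases eq_or_ne v [] with rfl | hv
    · exact ⟨u, 1, 0, (wordPow_one u).symm, rfl⟩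
    have hu' := List.length_pos_iff.2 hu
    have hv' := List.length_pos_iff.2 hv
    -- The Euclidean algorithm on lengths: the shorter word is a prefix of the longer one, and the
    -- remainder still commutes with it.
    rcases le_total u.length v.length with hl | hl
    · obtain ⟨v', rfl⟩ : u <+: v :=
        List.prefix_of_prefix_length_le (List.prefix_append u v) (h ▸ List.prefix_append v u) hl
      obtain ⟨c, i, j, rfl, rfl⟩ := ih (u.length + v'.length) (by simp at hn; omega)
        (u := u) (v := v') (by simpa using h) rfl
      exact ⟨c, i, i + j, rfl, (wordPow_add _ _ _).symm⟩
    · obtain ⟨u', rfl⟩ : v <+: u :=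
        List.prefix_of_prefix_length_le (List.prefix_append v u) (h ▸ List.prefix_append u v) hl
      obtain ⟨c, i, j, rfl, rfl⟩ := ih (u'.length + v.length) (by simp at hn; omega)
        (u := u') (v := v) (by simpa using h) rfl
      exact ⟨c, j + i, j, (wordPow_add _ _ _).symm, rfl⟩

/-- A word that commutes with a proper power of `t` commutes with `t`. -/
theorem append_comm_of_wordPow {y t : Word N} {e : ℕ}
    (h : y ++ wordPow t (e + 1) = wordPow t (e + 1) ++ y) : y ++ t = t ++ y := by
  rcases eq_or_ne t [] with rfl | ht
  · simp
  induction hn : y.length using Nat.strong_induction_on generalizing y with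
  | _ n ih =>
    -- Copies of t are stripped from y until y is shorter than t. Then yt and ty are prefixes of
    -- equal length of the same word.
    rcases le_total t.length y.length with hl | hl
    · obtain ⟨y', rfl⟩ : t <+: y := by
        refine List.prefix_of_prefix_length_le (l₃ := y ++ wordPow t (e + 1)) ?_
          (List.prefix_append _ _) hl
        rw [h, wordPow_succ, List.append_assoc]
        exact List.prefix_append _ _
      have := List.length_pos_iff.2 ht
      have h1 := ih y'.length (by simp at hn; omega) (y := y') (by
        rw [List.append_assoc, ← List.append_assoc _ t, ← wordPow_succ', wordPow_succ _ (e + 1),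
          List.append_assoc] at h
        exact List.append_cancel_left h) rfl
      rw [List.append_assoc, h1]
    · have hy : y <+: wordPow t e ++ y := by
        rcases e with _ | e
        · exact List.prefix_rfl
        · have ht' : ∀ n, t <+: wordPow t (n + 1) ++ y := fun n => by
            rw [wordPow_succ, List.append_assoc]
            exact List.prefix_append _ _
          have hyt : y <+: t :=
            List.prefix_of_prefix_length_le (List.prefix_append _ _) (h ▸ ht' _) hl
          exact hyt.trans (ht' e)
      have h1 : y ++ t <+: y ++ wordPow t (e + 1) := by
        rw [wordPow_succ, ← List.append_assoc]; exact List.prefix_append _ _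
      have h2 : t ++ y <+: y ++ wordPow t (e + 1) := by
        rw [h, wordPow_succ, List.append_assoc]
        exact (List.prefix_append_right_inj t).2 hy
      exact List.prefix_of_prefix_length_le h1 h2 (by simp; omega) |>.eq_of_length (by simp; omega)

/-! ### Products of reduced words -/

theorem first_append_iff {b : Fin N × Bool} {u v : Word N} :
    First Γ b (u ++ v) ↔ First Γ b u ∨ ((∀ x ∈ u, Indep Γ x b) ∧ First Γ b v) := by
  induction u with
  | nil => simp
  | cons x u ih =>
    rw [List.cons_append, first_cons, ih, first_cons, List.forall_mem_cons]
    tauto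

/-- A cancellation between w and s would have to cross p, but p contains a letter with the same
generator, which blocks it. -/
theorem Reduced.append_append {w p s : Word N} (h : Reduced Γ (w ++ p)) (h' : Reduced Γ (p ++ s))
    (hw : ∀ l ∈ w, ∃ x ∈ p, x.1 = l.1) : Reduced Γ (w ++ p ++ s) := by
  induction w with
  | nil => exact h'
  | cons l w ih =>
    rw [List.cons_append, reduced_cons] at h
    rw [List.cons_append, List.cons_append, reduced_cons]
    refine ⟨ih h.1 fun m hm => hw m (by simp [hm]), fun hf => h.2 (hf.of_append ?_)⟩
    obtain ⟨x, hx, e⟩ := hw l (by simp)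
    exact ⟨x, by simp [hx], e⟩

theorem Reduced.wordPow {u : Word N} (h : Reduced Γ (u ++ u)) (n : ℕ) :
    Reduced Γ (wordPow u n) := by
  induction n with
  | zero => exact reduced_nil
  | succ n ih =>
    rcases n with _ | n
    · rw [wordPow_one]; exact h.of_append_left
    · rw [wordPow_succ, wordPow_succ, ← List.append_assoc]
      rw [wordPow_succ] at ih
      exact h.append_append ih fun l hl => ⟨l, hl, rfl⟩

/-- If a reduced word has a square that is not reduced, then some letter cancels cyclically. -/
theorem exists_cyclic_cancel {w : Word N} (h : Reduced Γ w) (h' : ¬ Reduced Γ (w ++ w)) :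
    ∃ (x₁ x₂ x₃ : Word N) (l : Fin N × Bool), w = x₁ ++ bar l :: x₂ ++ l :: x₃ ∧
      (∀ x ∈ x₁, Indep Γ x l) ∧ ∀ x ∈ x₃, Indep Γ x l := by
  by_contra hc
  refine h' ?_
  have key : ∀ s p : Word N, w = p ++ s → Reduced Γ (s ++ w) := by
    intro s
    induction s with
    | nil => exact fun _ _ => h
    | cons l s ih =>
      intro p hp
      rw [List.cons_append, reduced_cons]
      refine ⟨ih (p ++ [l]) (by simp [hp]), fun hf => ?_⟩
      rcases first_append_iff.1 hf with hf | ⟨hs, hf⟩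
      · exact (reduced_cons.1 (Reduced.of_append_right (hp ▸ h))).2 hf
      · obtain ⟨p', q', e, hp'⟩ := first_iff.1 hf
        rw [hp] at e
        -- The cancelling inverse in the second copy of w must stand before the position of l
        -- itself, since it cannot be moved across l. That is a cyclic cancellation inside w.
        rcases List.append_eq_append_iff.1 e with ⟨a, e1, e2⟩ | ⟨a, e1, e2⟩
        · rcases a with _ | ⟨y, a⟩
          · exact bar_ne l (List.cons.inj e2).1.symm
          · obtain ⟨rfl, -⟩ := List.cons.inj e2
            exact not_indep_self (Γ := Γ) l (hp' l (by simp [e1]))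
        · rcases a with _ | ⟨y, a⟩
          · exact bar_ne l (List.cons.inj e2).1
          · obtain ⟨rfl, rfl⟩ := List.cons.inj e2
            exact hc ⟨p', a, s, l, by simp [hp, e1], hp', hs⟩
  exact key w [] rfl

theorem CyclicallyReduced.append_self {w : Word N} (h : CyclicallyReduced Γ w) :
    Reduced Γ (w ++ w) := by
  by_contra h'
  obtain ⟨x₁, x₂, x₃, l, hw, h1, h3⟩ := exists_cyclic_cancel h.1 h'
  refine h.2 ⟨x₁, x₂, x₃, l.1, !l.2, by simpa [bar] using hw, fun y hy => ?_, fun y hy => ?_⟩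
  · exact (h1 y hy).symm.2
  · exact (h3 y hy).symm.2

/-- Cancellation in a product of reduced words. -/
theorem exists_cancel {u v : Word N} (hu : Reduced Γ u) (hv : Reduced Γ v) :
    ∃ p q s : Word N, Swap Γ u (p ++ q) ∧ elt Γ u * elt Γ v = elt Γ (p ++ s) ∧
      Reduced Γ (p ++ s) ∧ q.length + s.length = v.length := by
  induction u with
  | nil => exact ⟨[], [], v, .refl _, by simp [elt_nil], hv, by simp⟩
  | cons l u ih =>
    obtain ⟨p, q, s, h1, h2, h3, h4⟩ := ih (reduced_cons.1 hu).1
    by_cases hf : First Γ (bar l) (p ++ s)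
    · rcases first_append_iff.1 hf with hf | ⟨hp, hf⟩
      · exact absurd ((h1.first_iff _).2 (hf.append q)) (reduced_cons.1 hu).2
      · have hs := hf.swap_cons_erase
        have hm : Swap Γ (p ++ s) (bar l :: p ++ s.erase (bar l)) := by
          refine (hs.append_left p).trans ?_
          simpa using (swap_move (bar l) p hp).append_right (s.erase (bar l))
        refine ⟨p, l :: q, s.erase (bar l), ?_, ?_, ?_, ?_⟩
        · refine (h1.cons l).trans ?_
          simpa using (swap_move l p hp).symm.append_right q
        · rw [elt_cons l u, mul_assoc, h2, hm.elt_eq, List.cons_append, elt_cons (bar l), elt_bar,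
            mul_inv_cancel_left]
        · exact (reduced_cons.1 (hm.reduced_iff.1 h3)).1
        · have := List.length_pos_of_mem hf.mem
          rw [List.length_erase_of_mem hf.mem, List.length_cons]
          omega
    · refine ⟨l :: p, q, s, h1.cons l, ?_, reduced_cons.2 ⟨h3, hf⟩, h4⟩
      rw [elt_cons l u, mul_assoc, h2, ← elt_cons, List.cons_append]

/-- Multiplication by a large power of a cyclically reduced word `w` absorbs all cancellation. -/
theorem exists_reduced_append {w : Word N} (hw : CyclicallyReduced Γ w) (g : RAAGroup Γ) :
    ∃ (n : ℕ) (x : Word N), elt Γ w ^ n * g = elt Γ x ∧ Reduced Γ (w ++ x) := by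
  obtain ⟨v, hv, rfl⟩ := exists_reduced g
  have hpow := hw.append_self.wordPow
  -- Each letter of w occurs at least |v| + 1 times in this power, while the cancelled part q has
  -- length at most |v|. So every letter of w survives in p, and p separates a further factor w from
  -- s.
  obtain ⟨p, q, s, h1, h2, h3, h4⟩ := exists_cancel (hpow (v.length + 1)) hv
  refine ⟨v.length + 1, p ++ s, by rw [← elt_wordPow, h2], ?_⟩
  rw [← List.append_assoc]
  refine Reduced.append_append ?_ h3 fun l hl => ?_
  · have := hpow (v.length + 1 + 1)
    rw [wordPow_succ, (h1.append_left w).reduced_iff, ← List.append_assoc] at this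
    exact this.of_append_left
  · by_contra hc
    push Not at hc
    have hlp : l ∉ p := fun h => hc l h rfl
    have hcount : v.length + 1 ≤ (wordPow w (v.length + 1)).count l := by
      rw [wordPow, List.count_flatten, List.map_replicate, List.sum_replicate, smul_eq_mul]
      exact Nat.le_mul_of_pos_right _ (List.count_pos_iff.2 hl)
    rw [h1.perm.count_eq, List.count_append, List.count_eq_zero_of_not_mem hlp] at hcount
    have := List.count_le_length (a := l) (l := q)
    omega

/-- Elements of the centralizer of `[w]` are represented, up to powers of `[w]`, by words that
commute with `w` up to trace equivalence. -/
theorem exists_swap_comm {w : Word N} (hw : CyclicallyReduced Γ w) {g : RAAGroup Γ}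
    (hg : Commute (elt Γ w) g) :
    ∃ (n : ℕ) (x : Word N), elt Γ w ^ n * g = elt Γ x ∧ Swap Γ (w ++ x) (x ++ w) := by
  obtain ⟨n, x, h, hr⟩ := exists_reduced_append hw g
  have he : elt Γ (x ++ w) = elt Γ (w ++ x) := by
    rw [elt_append, elt_append, ← h]
    exact ((((Commute.refl _).pow_right n).mul_right hg).eq).symm
  -- The word xw has the length of the reduced word wx and represents the same element, so it is
  -- reduced as well.
  refine ⟨n, x, h, swap_of_elt_eq hr (reduced_of_length_le hr he ?_) he.symm⟩
  simp [add_comm]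

/-- Right-angled Artin groups are torsion-free. -/
theorem eq_one_of_pow_eq_one {g : RAAGroup Γ} {n : ℕ} (hn : n ≠ 0) (h : g ^ n = 1) : g = 1 := by
  obtain ⟨u, rfl⟩ := elt_surjective g
  induction hk : u.length using Nat.strong_induction_on generalizing u with
  | _ k ih =>
    -- A word that is not reduced is shortened by reduction, and one whose square is not reduced is
    -- shortened by conjugation with a letter. In the remaining case all powers are reduced, so a
    -- nonempty word has no trivial positive power.
    by_cases hu : Reduced Γ u
    · by_cases huu : Reduced Γ (u ++ u)
      · have h1 := huu.wordPow n
        rw [← elt_wordPow] at h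
        have h2 : wordPow u n = [] := by
          by_contra h3
          exact elt_ne_one h1 h3 h
        have h3 := length_wordPow u n
        rw [h2] at h3
        have : u = [] := by
          rcases Nat.mul_eq_zero.1 h3.symm with h4 | h4
          · exact absurd h4 hn
          · exact List.length_eq_zero_iff.1 h4
        rw [this, elt_nil]
      · obtain ⟨x₁, x₂, x₃, l, e, hx₁, hx₃⟩ := exists_cyclic_cancel hu huu
        have hs : Swap Γ u (bar l :: (x₁ ++ x₂ ++ x₃) ++ [l]) := by
          rw [e]
          have h1 := (swap_move (bar l) x₁ hx₁).append_right (x₂ ++ l :: x₃)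
          have h2 := ((swap_move l x₃ hx₃).symm.append_left (bar l :: x₁ ++ x₂))
          simp only [List.append_assoc, List.cons_append, List.nil_append] at h1 h2 ⊢
          exact h1.trans h2
        have he : elt Γ u = (elt Γ [l])⁻¹ * elt Γ (x₁ ++ x₂ ++ x₃) * (elt Γ [l])⁻¹⁻¹ := by
          rw [hs.elt_eq, elt_append, elt_cons (bar l), elt_bar, inv_inv]
        rw [he, conj_pow, conj_eq_one_iff] at h
        rw [he, conj_eq_one_iff]
        refine ih _ ?_ _ h rfl
        rw [← hk, e]
        simp
    · have hlt : (reduce Γ u).length < u.length := by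
        by_contra hc
        rw [← (reduce_of_length (Γ := Γ) u).2 (not_lt.1 hc)] at hu
        exact hu (reduced_reduce u)
      rw [← elt_reduce u] at h ⊢
      exact ih _ (hk ▸ hlt) _ h rfl

/-! ### Lexicographic normal forms of traces -/

/-- The first letter of each suffix has the largest index among the first letters of the trace
equivalent words. -/
def LexNormal (Γ : SimpleGraph (Fin N)) : Word N → Prop
  | [] => True
  | a :: t => LexNormal Γ t ∧ ∀ b, First Γ b (a :: t) → b.1 ≤ a.1

/-- Every possible first letter starts a trace equivalent word, which is again reduced and so
competes in the definition of normality. From here on only this consequence of normality is used. -/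
theorem Normal.lexNormal {w : Word N} (h : Normal Γ w) : LexNormal Γ w := by
  induction w with
  | nil => trivial
  | cons a t ih =>
    refine ⟨ih ⟨(reduced_cons.1 h.1).1, fun v hv => h.2 v (hv.trans (List.suffix_cons a t))⟩,
      fun b hb => ?_⟩
    have hs := hb.swap_cons_erase
    exact h.2 _ List.suffix_rfl a t rfl b _ (hs.reduced_iff.1 h.1) hs.elt_eq.symm

theorem LexNormal.append {u v : Word N} (hu : LexNormal Γ u) (hv : LexNormal Γ v)
    (h : ∀ b, First Γ b v → ∀ a ∈ u, b.1 ≤ a.1) : LexNormal Γ (u ++ v) := by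
  induction u with
  | nil => exact hv
  | cons a u ih =>
    refine ⟨ih hu.1 fun b hb c hc => h b hb c (by simp [hc]), fun b hb => ?_⟩
    rcases (first_append_iff (u := a :: u)).1 hb with hb | ⟨-, hb⟩
    · exact hu.2 b hb
    · exact h b hb a (by simp)

/-- Each head is a possible first letter of the other word, so the two indices agree. Letters with
the same generator cannot pass each other, so the heads are equal and can be cancelled. -/
theorem LexNormal.eq_of_swap {u v : Word N} (hu : LexNormal Γ u) (hv : LexNormal Γ v)
    (h : Swap Γ u v) : u = v := by
  induction u generalizing v with
  | nil => exact (List.nil_perm.1 h.perm).symm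
  | cons a u ih =>
    rcases v with _ | ⟨b, v⟩
    · exact absurd h.perm.length_eq (by simp)
    have hb : First Γ b (a :: u) := (h.first_iff b).2 (.inl rfl)
    have ha : First Γ a (b :: v) := (h.first_iff a).1 (.inl rfl)
    have hab : a.1 = b.1 := le_antisymm (hv.2 a ha) (hu.2 b hb)
    rcases hb with rfl | hb
    · rw [ih hu.1 hv.1 h.of_cons]
    · exact absurd hab hb.1.1

theorem exists_lexNormal (u : Word N) : ∃ v, LexNormal Γ v ∧ Swap Γ u v := by
  classical
  induction hn : u.length generalizing u with
  | zero => exact ⟨[], trivial, by rw [List.length_eq_zero_iff.1 hn]; exact .refl _⟩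
  | succ n ih =>
    obtain ⟨a, t, rfl⟩ := List.exists_cons_of_length_eq_add_one hn
    obtain ⟨b, hb, hmax⟩ := Finset.exists_max_image
      (Finset.univ.filter fun b => First Γ b (a :: t)) Prod.fst ⟨a, by simp [first_cons]⟩
    simp only [Finset.mem_filter, Finset.mem_univ, true_and] at hb hmax
    have hs := hb.swap_cons_erase
    obtain ⟨v, hv, hv'⟩ := ih ((a :: t).erase b) (by rw [List.length_erase_of_mem hb.mem, hn]; rfl)
    have hs' := hs.trans (hv'.cons b)
    exact ⟨b :: v, ⟨hv, fun c hc => hmax c ((hs'.first_iff c).2 hc)⟩, hs'⟩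

/-- Commutation up to trace equivalence with a normal word that starts with its smallest
generator is commutation of words. -/
theorem LexNormal.append_comm {h : Fin N × Bool} {w y : Word N} (hw : LexNormal Γ (h :: w))
    (hy : LexNormal Γ y) (hmin : ∀ l ∈ h :: w, h.1 ≤ l.1)
    (hsupp : ∀ l ∈ y, ∃ x ∈ h :: w, x.1 = l.1)
    (hs : Swap Γ (h :: w ++ y) (y ++ h :: w)) : h :: w ++ y = y ++ h :: w := by
  -- Both products are normal. A first letter of y is also one of the product starting with h, hence
  -- one of the word h :: w itself, whose first letters have index at most that of h, the minimum
  -- over all letters involved.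
  refine LexNormal.eq_of_swap (hw.append hy fun b hb a ha => ?_)
    (hy.append hw fun b hb a ha => ?_) hs
  · have h1 := ((hs.first_iff b).2 (hb.append _)).of_append (hsupp b hb.mem)
    exact (hw.2 b h1).trans (hmin a ha)
  · obtain ⟨x, hx, e⟩ := hsupp a ha
    exact (hw.2 b hb).trans (e ▸ hmin x hx)

/-! ### Centralizers -/

/-- The word `w` is a power of `z` with the largest possible exponent. -/
def IsWordRoot (w z : Word N) : Prop :=
  ∃ r : ℕ, w = wordPow z r ∧ ∀ (z' : Word N) (r' : ℕ), w = wordPow z' r' → r' ≤ r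

/-- The problem is conjugated so that w starts with its smallest generator. There trace commutation
is commutation of words, and a word commuting with a power of a primitive word is a power of that
primitive word. -/
theorem elt_mem_zpowers_of_swap_comm {w z x : Word N} (hw : CyclicNormalForm Γ w) (hne : w ≠ [])
    (hz : IsWordRoot w z) (hx : ∀ l ∈ x, ∃ m ∈ w, m.1 = l.1) (hs : Swap Γ (w ++ x) (x ++ w)) :
    elt Γ x ∈ Subgroup.zpowers (elt Γ z) := by
  obtain ⟨r, hr, hmax⟩ := hz
  rcases r with _ | e
  · exact absurd hr hne
  obtain ⟨l, hl, hmin⟩ := Finset.exists_min_image w.toFinset Prod.fst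
    ((List.toFinset_nonempty_iff w).2 hne)
  simp only [List.mem_toFinset] at hl hmin
  rw [hr, mem_wordPow (Nat.succ_ne_zero e)] at hl
  obtain ⟨t₁, t₂, rfl⟩ := List.append_of_mem hl
  set t := t₁ ++ l :: t₂ with ht
  set t' := l :: t₂ ++ t₁ with ht'
  have hw' : wordPow t' (e + 1) = l :: t₂ ++ wordPow t e ++ t₁ :=
    (append_wordPow_append t₁ (l :: t₂) e).symm
  have hrot : w ~r wordPow t' (e + 1) := by
    rw [hw', hr, wordPow_succ, ht, List.append_assoc]
    exact List.isRotated_append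
  have hwt : ∀ x, x ∈ wordPow t' (e + 1) ↔ x ∈ w := fun x => hrot.perm.mem_iff.symm
  have hln : LexNormal Γ (wordPow t' (e + 1)) := (hw.2 _ hrot.symm).lexNormal
  -- This word represents the conjugate of [x] by [l t₂], multiplied by [t']. The extra factor
  -- commutes with [t'] and avoids inverse letters.
  obtain ⟨y, hy, hxy⟩ := exists_lexNormal (Γ := Γ) (l :: t₂ ++ x ++ t₁)
  have hs1 : Swap Γ (wordPow t' (e + 1) ++ (l :: t₂ ++ x ++ t₁))
      ((l :: t₂ ++ x ++ t₁) ++ wordPow t' (e + 1)) := by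
    have h1 := (hs.append_left (l :: t₂)).append_right t₁
    rw [hr] at h1
    have e1 : wordPow t' (e + 1) ++ (l :: t₂ ++ x ++ t₁) =
        l :: t₂ ++ (wordPow t (e + 1) ++ x) ++ t₁ := by
      rw [hw', wordPow_succ', ht]; simp
    have e2 : (l :: t₂ ++ x ++ t₁) ++ wordPow t' (e + 1) =
        l :: t₂ ++ (x ++ wordPow t (e + 1)) ++ t₁ := by
      rw [hw', wordPow_succ, ht]; simp
    rw [e1, e2]
    exact h1
  have hs2 : Swap Γ (wordPow t' (e + 1) ++ y) (y ++ wordPow t' (e + 1)) :=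
    ((hxy.symm.append_left _).trans hs1).trans (hxy.append_right _)
  have hcomm : wordPow t' (e + 1) ++ y = y ++ wordPow t' (e + 1) := by
    have hcons : wordPow t' (e + 1) = l :: (t₂ ++ wordPow t e ++ t₁) := by rw [hw']; simp
    rw [hcons] at hln hs2 hwt ⊢
    refine hln.append_comm hy (fun m hm => hmin m ((hwt m).1 hm)) (fun m hm => ?_) hs2
    rw [← hxy.perm.mem_iff] at hm
    have : m ∈ x ∨ m ∈ t := by
      simp only [ht, List.mem_append, List.mem_cons] at hm ⊢
      tauto
    rcases this with hm | hm
    · obtain ⟨n, hn, e⟩ := hx m hm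
      exact ⟨n, (hwt n).2 hn, e⟩
    · exact ⟨m, (hwt m).2 (by rw [hr]; exact (mem_wordPow (Nat.succ_ne_zero e)).2 hm), rfl⟩
  obtain ⟨c, i, j, hi, hj⟩ := exists_wordPow_of_append_comm (append_comm_of_wordPow hcomm.symm)
  -- Otherwise the rotation of w, and hence w itself, would be a power with an exponent larger than
  -- the maximal e + 1.
  have hj1 : j = 1 := by
    have h1 : wordPow t' (e + 1) = wordPow c (j * (e + 1)) := by rw [hj, wordPow_mul]
    obtain ⟨d, hd⟩ := exists_wordPow_of_isRotated h1 hrot.symm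
    have h2 := hmax d _ hd
    have h3 : j ≠ 0 := by
      rintro rfl
      simp [ht', wordPow_zero] at hj
    have : j * (e + 1) ≤ 1 * (e + 1) := by omega
    have := Nat.le_of_mul_le_mul_right this (Nat.succ_pos e)
    omega
  rw [hj1, wordPow_one] at hj
  have hy' : elt Γ (l :: t₂) * elt Γ x * elt Γ t₁ = (elt Γ (l :: t₂) * elt Γ t₁) ^ i := by
    rw [← elt_append, ← elt_append, ← elt_append, hxy.elt_eq, hi, elt_wordPow, ← hj]
  have hx' : elt Γ t * elt Γ x = elt Γ t ^ i := by
    have h1 : elt Γ t = elt Γ t₁ * elt Γ (l :: t₂) := elt_append _ _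
    have h2 : elt Γ t = elt Γ t₁ * (elt Γ (l :: t₂) * elt Γ t₁) * (elt Γ t₁)⁻¹ := by
      rw [h1]; group
    rw [h2, conj_pow, ← hy']; group
  rw [eq_inv_mul_of_mul_eq hx']
  exact mul_mem (inv_mem (Subgroup.mem_zpowers _)) (pow_mem (Subgroup.mem_zpowers _) i)

theorem mem_support {w : Word N} {a : Fin N} : a ∈ support w ↔ ∃ l ∈ w, l.1 = a := Iff.rfl

theorem mem_support_flatten {ws : List (Word N)} {a : Fin N} :
    a ∈ support ws.flatten ↔ ∃ w ∈ ws, a ∈ support w := by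
  simp only [mem_support, List.mem_flatten]
  constructor
  · rintro ⟨l, ⟨w, hw, hl⟩, e⟩; exact ⟨w, hw, l, hl, e⟩
  · rintro ⟨w, hw, l, hl, e⟩; exact ⟨l, ⟨w, hw, hl⟩, e⟩

/-! ### Letters outside the support, and splitting into factors -/

/-- The projections of a trace to pairs of non-commuting generators are well defined. -/
theorem Swap.filter_pair {a b : Fin N} (hab : Γ.Adj a b) {u v : Word N} (h : Swap Γ u v) :
    u.filter (fun l => l.1 = a ∨ l.1 = b) = v.filter (fun l => l.1 = a ∨ l.1 = b) := by
  refine h.invariant (List.filter (fun l => l.1 = a ∨ l.1 = b)) fun p q l m h => ?_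
  simp only [List.filter_append, List.filter_cons]
  split_ifs with h1 h2
  · simp only [decide_eq_true_eq] at h1 h2
    exfalso
    rcases h1 with h1 | h1 <;> rcases h2 with h2 | h2
    · exact h.1 (h1.trans h2.symm)
    · exact h.2 (h1 ▸ h2 ▸ hab)
    · exact h.2 (h1 ▸ h2 ▸ hab.symm)
    · exact h.1 (h1.trans h2.symm)
  all_goals rfl

/-- After projection to an adjacent pair, the two words commute in a free monoid and are powers of a
common word. The letter m makes the exponent for w positive, so every letter left from x, including
l, also occurs in w. -/
theorem not_adj_of_swap_comm {w x : Word N} (hs : Swap Γ (w ++ x) (x ++ w)) {l m : Fin N × Bool}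
    (hl : l ∈ x) (hlw : l.1 ∉ support w) (hm : m ∈ w) : ¬ Γ.Adj l.1 m.1 := by
  intro hadj
  have h1 := hs.filter_pair hadj
  rw [List.filter_append, List.filter_append] at h1
  obtain ⟨c, i, j, hi, hj⟩ := exists_wordPow_of_append_comm h1
  have hl' : l ∈ wordPow c j := by rw [← hj]; simp [hl]
  have hm' : m ∈ wordPow c i := by rw [← hi]; simp [hm]
  have hi0 : i ≠ 0 := by rintro rfl; simp [wordPow_zero] at hm'
  have := (mem_wordPow hi0).2 (mem_of_mem_wordPow hl')
  rw [← hi] at this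
  exact hlw ⟨l, (List.mem_filter.1 this).1, rfl⟩

theorem elt_eq_filter_mul_filter {x : Word N} (f : Fin N × Bool → Bool)
    (h : ∀ l ∈ x, ∀ m ∈ x, f l = true → f m = false → ¬ Γ.Adj l.1 m.1) :
    elt Γ x = elt Γ (x.filter f) * elt Γ (x.filter fun l => !f l) := by
  induction x with
  | nil => simp [elt_nil]
  | cons l x ih =>
    have ih := ih fun l hl m hm => h l (by simp [hl]) m (by simp [hm])
    rw [elt_cons, ih]
    cases hf : f l
    · rw [List.filter_cons_of_neg (by simp [hf]), List.filter_cons_of_pos (by simp [hf]),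
        elt_cons l (x.filter fun l => !f l), ← mul_assoc, ← mul_assoc]
      congr 1
      refine (elt_commute fun a ha b hb => ?_).eq
      rw [List.mem_singleton.1 ha]
      have hb := List.mem_filter.1 hb
      exact fun hadj => h b (by simp [hb.1]) l (by simp) hb.2 hf hadj.symm
    · rw [List.filter_cons_of_pos hf, List.filter_cons_of_neg (by simp [hf]),
        elt_cons l (x.filter f), mul_assoc]

/-- A subgroup that contains the letters of a word contains the element it represents. -/
theorem elt_mem_of_letters {H : Subgroup (RAAGroup Γ)} {x : Word N}
    (h : ∀ l ∈ x, elt Γ [l] ∈ H) : elt Γ x ∈ H := by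
  induction x with
  | nil => rw [elt_nil]; exact one_mem H
  | cons l x ih =>
    rw [elt_cons]
    exact mul_mem (h l (by simp)) (ih fun m hm => h m (by simp [hm]))

-- The letters of x supported on one factor can be collected in front, since they commute with all
-- other letters of x. Repeating this for every factor leaves only letters outside all supports.
open Classical in
theorem elt_mem_of_filter_mem {H : Subgroup (RAAGroup Γ)} {ws : List (Word N)} {x : Word N}
    (hsep : ws.Pairwise fun u v => Disjoint (support u) (support v))
    (hx : ∀ l ∈ x, ∀ w ∈ ws, l.1 ∉ support w → ∀ m ∈ w, ¬ Γ.Adj l.1 m.1)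
    (hf : ∀ w ∈ ws, elt Γ (x.filter fun l => l.1 ∈ support w) ∈ H)
    (hl : ∀ l ∈ x, (∀ w ∈ ws, l.1 ∉ support w) → elt Γ [l] ∈ H) : elt Γ x ∈ H := by
  induction ws generalizing x with
  | nil => exact elt_mem_of_letters fun l hlx => hl l hlx (by simp)
  | cons w ws ih =>
    rw [List.pairwise_cons] at hsep
    rw [elt_eq_filter_mul_filter fun l => l.1 ∈ support w]
    · refine mul_mem (hf w (by simp)) (ih hsep.2 (fun l hl v hv => ?_) (fun v hv => ?_)
        fun l hlx hlw => ?_)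
      · exact hx l (List.mem_filter.1 hl).1 v (by simp [hv])
      · have h1 := hf v (by simp [hv])
        rw [List.filter_filter]
        convert h1 using 2
        refine List.filter_congr fun l _ => ?_
        rw [Bool.and_eq_left_iff_imp]
        simp only [decide_eq_true_eq, Bool.not_eq_true', decide_eq_false_iff_not]
        exact fun h2 h3 => (hsep.1 v hv).le_bot ⟨h3, h2⟩
      · rw [List.mem_filter] at hlx
        refine hl l hlx.1 fun v hv => ?_
        rcases List.mem_cons.1 hv with rfl | hv
        · simpa using hlx.2
        · exact hlw v hv
    · intro l hl m hm h1 h2 hadj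
      simp only [decide_eq_true_eq, decide_eq_false_iff_not] at h1 h2
      obtain ⟨n, hn, e⟩ := h1
      exact hx m hm w (by simp) h2 n hn (e ▸ hadj.symm)

theorem IsNonSplitDecomposition.separated_of_ne {ws : List (Word N)}
    (h : IsNonSplitDecomposition Γ ws) {u v : Word N} (hu : u ∈ ws) (hv : v ∈ ws) (hne : u ≠ v)
    {a b : Fin N} (ha : a ∈ support u) (hb : b ∈ support v) : a ≠ b ∧ ¬ Γ.Adj a b := by
  have hsymm : Std.Symm fun u v : Word N =>
      ∀ a ∈ support u, ∀ b ∈ support v, a ≠ b ∧ GenCommute Γ a b :=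
    ⟨fun u v h a ha b hb => ⟨(h b hb a ha).1.symm, fun h' => (h b hb a ha).2 h'.symm⟩⟩
  exact h.separated.forall hu hv hne a ha b hb

open Classical in
theorem IsNonSplitDecomposition.filter_flatten {ws : List (Word N)}
    (h : IsNonSplitDecomposition Γ ws) {w : Word N} (hw : w ∈ ws) :
    ws.flatten.filter (fun l => l.1 ∈ support w) = w := by
  have hsep := h.separated
  have hself : w.filter (fun l => l.1 ∈ support w) = w := by
    refine List.filter_eq_self.2 fun l hl => ?_
    simpa using ⟨l, hl, rfl⟩
  clear h
  induction ws with
  | nil => simp at hw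
  | cons v ws ih =>
    rw [List.pairwise_cons] at hsep
    rw [List.flatten_cons, List.filter_append]
    rcases List.mem_cons.1 hw with rfl | hw
    · rw [hself, List.filter_eq_nil_iff.2, List.append_nil]
      intro l hl
      obtain ⟨u, hu, hlu⟩ := List.mem_flatten.1 hl
      simp only [decide_eq_true_eq]
      exact fun h => (hsep.1 u hu _ h _ ⟨l, hlu, rfl⟩).1 rfl
    · rw [ih hw hsep.2, List.filter_eq_nil_iff.2, List.nil_append]
      intro l hl
      simp only [decide_eq_true_eq]
      exact fun h => (hsep.1 w hw _ ⟨l, hl, rfl⟩ _ h).1 rfl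

theorem IsNonSplitDecomposition.support_disjoint {ws : List (Word N)}
    (h : IsNonSplitDecomposition Γ ws) :
    ws.Pairwise fun u v => Disjoint (support u) (support v) :=
  h.separated.imp fun h => Set.disjoint_left.2 fun a ha hb => (h a ha a hb).1 rfl

/-- A subgroup that contains the roots of the factors and the generators that do not occur in
the factors and commute with them contains the centralizer. -/
theorem IsNonSplitDecomposition.mem_of_commute {ws : List (Word N)}
    (h : IsNonSplitDecomposition Γ ws) {H : Subgroup (RAAGroup Γ)}
    (hroot : ∀ w ∈ ws, ∃ z, IsWordRoot w z ∧ elt Γ z ∈ H)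
    (hgen : ∀ a ∉ support ws.flatten, (∀ b ∈ support ws.flatten, ¬ Γ.Adj a b) → gen Γ a ∈ H)
    {g : RAAGroup Γ} (hg : Commute (elt Γ ws.flatten) g) : g ∈ H := by
  classical
  obtain ⟨n, x, hx, hs⟩ := exists_swap_comm h.cyclicallyReduced hg
  have hW : elt Γ ws.flatten ∈ H := by
    have : ∀ w ∈ ws, elt Γ w ∈ H := fun w hw => by
      obtain ⟨z, ⟨r, rfl, -⟩, hz⟩ := hroot w hw
      rw [elt_wordPow]
      exact pow_mem hz r
    clear * - this
    induction ws with
    | nil => rw [List.flatten_nil, elt_nil]; exact one_mem H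
    | cons w ws ih =>
      rw [List.flatten_cons, elt_append]
      exact mul_mem (this w (by simp)) (ih fun v hv => this v (by simp [hv]))
  suffices hxH : elt Γ x ∈ H by
    rw [eq_inv_mul_of_mul_eq hx]
    exact mul_mem (inv_mem (pow_mem hW n)) hxH
  refine elt_mem_of_filter_mem h.support_disjoint (fun l hl w hw hlw m hm => ?_) (fun w hw => ?_)
    fun l hl hlw => ?_
  · by_cases hlW : l.1 ∈ support ws.flatten
    · obtain ⟨v, hv, hlv⟩ := mem_support_flatten.1 hlW
      exact (h.separated_of_ne hv hw (fun e => hlw (e ▸ hlv)) hlv ⟨m, hm, rfl⟩).2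
    · exact not_adj_of_swap_comm hs hl hlW (List.mem_flatten.2 ⟨w, hw, hm⟩)
  · obtain ⟨z, hz, hzH⟩ := hroot w hw
    -- Since supports of distinct factors are disjoint, filtering the whole product leaves exactly
    -- w.
    have hs' := hs.filter fun l => l.1 ∈ support w
    rw [List.filter_append, List.filter_append, h.filter_flatten hw] at hs'
    refine (Subgroup.zpowers_le.2 hzH) (elt_mem_zpowers_of_swap_comm (h.cyclicNormalForm w hw)
      (h.nonSplit w hw).1 hz (fun l hl => ?_) hs')
    exact mem_support.1 (by simpa using (List.mem_filter.1 hl).2)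
  · have hgl : gen Γ l.1 ∈ H := by
      have hlW : l.1 ∉ support ws.flatten := fun hlW => by
        obtain ⟨v, hv, hlv⟩ := mem_support_flatten.1 hlW
        exact hlw v hv hlv
      refine hgen _ hlW fun b hb => ?_
      obtain ⟨m, hm, rfl⟩ := hb
      exact not_adj_of_swap_comm hs hl hlW hm
    rcases l with ⟨a, _ | _⟩
    · rw [elt_gen_inv]; exact inv_mem hgl
    · exact hgl

/-! ### Minimal roots and the canonical generating set -/

theorem IsWordRoot.exists_succ {w z : Word N} (h : IsWordRoot w z) (hne : w ≠ []) :
    ∃ r, w = wordPow z (r + 1) := by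
  obtain ⟨r, hr, -⟩ := h
  rcases r with _ | r
  · exact absurd hr hne
  · exact ⟨r, hr⟩

theorem IsWordRoot.mem_iff {w z : Word N} (h : IsWordRoot w z) (hne : w ≠ [])
    {l : Fin N × Bool} : l ∈ w ↔ l ∈ z := by
  obtain ⟨r, rfl⟩ := h.exists_succ hne
  exact mem_wordPow (Nat.succ_ne_zero r)

/-- The word zz is a prefix of the reduced word ww, even if the exponent is 1, and a cyclic
cancellation in z would be an ordinary one in zz. -/
theorem IsWordRoot.cyclicallyReduced {w z : Word N} (h : IsWordRoot w z) (hne : w ≠ [])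
    (hw : CyclicallyReduced Γ w) : CyclicallyReduced Γ z := by
  obtain ⟨r, rfl⟩ := h.exists_succ hne
  have hzz : Reduced Γ (z ++ z) := by
    have h2 : Reduced Γ (z ++ (z ++ wordPow z r)) := by
      have h3 := hw.append_self
      rw [← wordPow_add, show r + 1 + (r + 1) = r + r + 1 + 1 by ring, wordPow_succ, wordPow_succ,
        wordPow_add, ← List.append_assoc, ← List.append_assoc] at h3
      rw [← List.append_assoc]
      exact h3.of_append_left
    rw [← List.append_assoc] at h2
    exact h2.of_append_left
  refine ⟨hzz.of_append_left, ?_⟩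
  rintro ⟨x₁, x₂, x₃, a, ε, hz, h1, h3⟩
  refine hzz ⟨x₁ ++ [(a, ε)] ++ x₂, x₃ ++ x₁, x₂ ++ [(a, !ε)] ++ x₃, a, !ε, by simp [hz], ?_⟩
  intro l hl
  rcases List.mem_append.1 hl with hl | hl
  · exact h3 l hl
  · exact h1 l hl

open Classical in
/-- The endomorphism that kills the generators in a set. -/
noncomputable def kill (Γ : SimpleGraph (Fin N)) (S : Set (Fin N)) : RAAGroup Γ →* RAAGroup Γ :=
  PresentedGroup.toGroup (f := fun a => if a ∈ S then 1 else gen Γ a) <| by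
    rintro r ⟨a, b, h, rfl⟩
    simp only [map_mul, map_inv, FreeGroup.lift_apply_of]
    rw [mul_inv_eq_one, mul_inv_eq_iff_eq_mul]
    split_ifs
    · rfl
    · simp
    · simp
    · exact (gen_commute h).eq

theorem kill_gen_of_mem {S : Set (Fin N)} {a : Fin N} (h : a ∈ S) : kill Γ S (gen Γ a) = 1 := by
  rw [kill, gen, PresentedGroup.toGroup.of, if_pos h]

theorem kill_gen_of_notMem {S : Set (Fin N)} {a : Fin N} (h : a ∉ S) :
    kill Γ S (gen Γ a) = gen Γ a := by
  rw [kill, gen, PresentedGroup.toGroup.of, if_neg h]; rfl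

theorem kill_elt {S : Set (Fin N)} {w : Word N} (h : ∀ l ∈ w, l.1 ∈ S) :
    kill Γ S (elt Γ w) = 1 := by
  rw [← MonoidHom.mem_ker]
  refine elt_mem_of_letters fun l hl => ?_
  have h1 : gen Γ l.1 ∈ (kill Γ S).ker := kill_gen_of_mem (h l hl)
  rcases l with ⟨a, _ | _⟩
  · rw [elt_gen_inv]; exact inv_mem h1
  · exact h1

theorem isNonSplitDecomposition_singleton {w : Word N} (hw : CyclicNormalForm Γ w)
    (hn : NonSplit Γ w) : IsNonSplitDecomposition Γ [w] where
  cyclicallyReduced := by simpa using hw.1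
  cyclicNormalForm := by simpa using hw
  nonSplit := by simpa using hn
  separated := List.pairwise_singleton _ _

/-- An element of which `[w]` is a power is a power of the root. -/
theorem mem_zpowers_root {w z : Word N} (hw : CyclicNormalForm Γ w) (hn : NonSplit Γ w)
    (hz : IsWordRoot w z) {g : RAAGroup Γ} {s : ℤ} (hg : g ^ s = elt Γ w) :
    g ∈ Subgroup.zpowers (elt Γ z) := by
  have hdec := isNonSplitDecomposition_singleton hw hn
  set ρ := kill Γ (support w) with hρ
  -- These are the elements that are a power of [z] times their image under ρ, where the image
  -- commutes with [z]. They include [z] and all central generators outside the support, hence the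
  -- centralizer of [w]. Since ρ kills [w], the image of g is torsion and thus trivial, which leaves
  -- a power of [z].
  let H : Subgroup (RAAGroup Γ) :=
    { carrier := {g | g * (ρ g)⁻¹ ∈ Subgroup.zpowers (elt Γ z) ∧ Commute (ρ g) (elt Γ z)}
      one_mem' := by simp
      mul_mem' := by
        rintro a b ⟨ha, ha'⟩ ⟨hb, hb'⟩
        refine ⟨?_, by rw [map_mul]; exact ha'.mul_left hb'⟩
        obtain ⟨k, hk⟩ := hb
        have : a * b * (ρ (a * b))⁻¹ = (a * (ρ a)⁻¹) * (b * (ρ b)⁻¹) := by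
          have h1 : Commute (ρ a) (b * (ρ b)⁻¹) := by
            rw [← hk]; exact ha'.zpow_right k
          rw [map_mul, mul_inv_rev, mul_assoc a (ρ a)⁻¹, h1.inv_left.eq]
          group
        rw [this, ← hk]
        exact mul_mem ha ⟨k, rfl⟩
      inv_mem' := by
        rintro a ⟨ha, ha'⟩
        refine ⟨?_, by rw [map_inv]; exact ha'.inv_left⟩
        obtain ⟨k, hk⟩ := ha
        have h1 : Commute (ρ a) (a * (ρ a)⁻¹) := by
          rw [← hk]; exact ha'.zpow_right k
        have : a⁻¹ * (ρ a⁻¹)⁻¹ = (a * (ρ a)⁻¹)⁻¹ := by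
          have h2 : a = (a * (ρ a)⁻¹) * ρ a := by group
          rw [map_inv, inv_inv]
          nth_rewrite 1 [h2]
          rw [← h1.eq]
          group
        rw [this, ← hk]
        exact inv_mem ⟨k, rfl⟩ }
  have hρz : ρ (elt Γ z) = 1 := kill_elt fun l hl => ⟨l, (hz.mem_iff hn.1).2 hl, rfl⟩
  have hgH : g ∈ H := by
    refine hdec.mem_of_commute (fun v hv => ⟨z, ?_, ?_⟩) (fun a haw ha => ?_) ?_
    · rw [List.mem_singleton.1 hv]; exact hz
    · refine ⟨?_, by rw [hρz]; exact Commute.one_left _⟩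
      rw [hρz, inv_one, mul_one]
      exact Subgroup.mem_zpowers _
    · simp only [List.flatten_cons, List.flatten_nil, List.append_nil] at ha haw
      have h1 : ρ (gen Γ a) = gen Γ a := kill_gen_of_notMem haw
      refine ⟨by rw [h1, mul_inv_cancel]; exact one_mem _, ?_⟩
      rw [h1, ← elt_gen]
      refine elt_commute fun l hl m hm => ?_
      rw [List.mem_singleton.1 hl]
      exact ha _ ⟨m, (hz.mem_iff hn.1).2 hm, rfl⟩
    · simp only [List.flatten_cons, List.flatten_nil, List.append_nil, ← hg]
      exact (Commute.refl g).zpow_left s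
  have h1 : ρ g ^ s = 1 := by
    rw [← map_zpow, hg]
    exact kill_elt fun l hl => ⟨l, hl, rfl⟩
  have hs : s ≠ 0 := by
    rintro rfl
    exact elt_ne_one hn.2.1 hn.1 (by rw [← hg, zpow_zero])
  have h2 : ρ g = 1 := by
    refine eq_one_of_pow_eq_one (Int.natAbs_ne_zero.2 hs) ?_
    rcases Int.natAbs_eq s with h | h
    · rwa [h, zpow_natCast] at h1
    · rwa [h, zpow_neg, zpow_natCast, inv_eq_one] at h1
  have h3 := hgH.1
  rwa [h2, inv_one, mul_one] at h3

/-- Every infinite cyclic subgroup through [w] lies in the one generated by [z]. A largest such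
subgroup is the only maximal one. -/
theorem isMinimalRoot_of_isWordRoot {w z : Word N} (hw : CyclicNormalForm Γ w)
    (hn : NonSplit Γ w) (hz : IsWordRoot w z) : IsMinimalRoot Γ w z := by
  obtain ⟨r, hr⟩ := hz.exists_succ hn.1
  have hmem : elt Γ w ∈ Subgroup.zpowers (elt Γ z) := by
    rw [hr, elt_wordPow]
    exact pow_mem (Subgroup.mem_zpowers _) _
  have hle : ∀ K, IsInfiniteCyclicThrough (elt Γ w) K → K ≤ Subgroup.zpowers (elt Γ z) := by
    rintro K ⟨hc, -, hwK⟩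
    obtain ⟨g, rfl⟩ := K.isCyclic_iff_exists_zpowers_eq_top.1 hc
    obtain ⟨s, hs⟩ := hwK
    exact Subgroup.zpowers_le.2 (mem_zpowers_root hw hn hz hs)
  have hself : IsInfiniteCyclicThrough (elt Γ w) (Subgroup.zpowers (elt Γ z)) := by
    refine ⟨inferInstance, ?_, hmem⟩
    rw [← SetLike.coe_sort_coe, Set.infinite_coe_iff, infinite_zpowers, isOfFinOrder_iff_pow_eq_one]
    rintro ⟨n, hn0, h1⟩
    refine elt_ne_one (hz.cyclicallyReduced hn.1 hw.1).1 ?_ (eq_one_of_pow_eq_one hn0.ne' h1)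
    rintro rfl
    exact hn.1 (by rw [hr, wordPow_nil])
  exact
    { cyclicallyReduced := hz.cyclicallyReduced hn.1 hw.1
      maximal := ⟨hself, fun K hK _ => hle K hK⟩
      unique := fun K hK => le_antisymm (hle K hK.1) (hK.2 hself (hle K hK.1))
      power := hz }

theorem commute_elt_flatten {ws : List (Word N)} {g : RAAGroup Γ}
    (h : ∀ w ∈ ws, Commute g (elt Γ w)) : Commute g (elt Γ ws.flatten) := by
  induction ws with
  | nil => rw [List.flatten_nil, elt_nil]; exact Commute.one_right g
  | cons w ws ih =>
    rw [List.flatten_cons, elt_append]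
    exact (h w (by simp)).mul_right (ih fun v hv => h v (by simp [hv]))

/-- The minimal roots and the generators that commute with all factors generate the
centralizer. -/
theorem IsNonSplitDecomposition.closure_eq_centralizer {ws zs : List (Word N)}
    (h : IsNonSplitDecomposition Γ ws) (hz : List.Forall₂ IsWordRoot ws zs) {gs : List (Fin N)}
    (hgs : ∀ a, a ∈ gs ↔ ∀ b ∈ support ws.flatten, ¬ Γ.Adj a b) :
    Subgroup.closure {g | ∃ v ∈ zs ++ gs.map (fun a => [(a, true)]), g = elt Γ v} =
      Subgroup.centralizer {elt Γ ws.flatten} := by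
  rw [List.forall₂_iff_get] at hz
  obtain ⟨hlen, hz⟩ := hz
  refine le_antisymm ((Subgroup.closure_le _).2 ?_) fun g hg => ?_
  · rintro _ ⟨v, hv, rfl⟩
    rw [SetLike.mem_coe, Subgroup.mem_centralizer_singleton_iff]
    suffices Commute (elt Γ v) (elt Γ ws.flatten) from this.eq
    rcases List.mem_append.1 hv with hv | hv
    · obtain ⟨i, hi, rfl⟩ := List.getElem_of_mem hv
      have hroot := hz i (hlen ▸ hi) hi
      have hmem : ws[i] ∈ ws := List.getElem_mem _
      simp only [List.get_eq_getElem] at hroot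
      refine commute_elt_flatten fun w hw => ?_
      by_cases e : w = ws[i]
      · obtain ⟨r, hr⟩ := hroot.exists_succ (h.nonSplit _ hmem).1
        rw [e, hr, elt_wordPow]
        exact (Commute.refl _).pow_right _
      · refine elt_commute fun l hl m hm => ?_
        exact (h.separated_of_ne hmem hw (Ne.symm e)
          ⟨l, (hroot.mem_iff (h.nonSplit _ hmem).1).2 hl, rfl⟩ ⟨m, hm, rfl⟩).2
    · obtain ⟨a, ha, rfl⟩ := List.mem_map.1 hv
      refine elt_commute fun l hl m hm => ?_
      rw [List.mem_singleton.1 hl]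
      exact (hgs a).1 ha _ ⟨m, hm, rfl⟩
  · rw [Subgroup.mem_centralizer_singleton_iff] at hg
    refine h.mem_of_commute (fun w hw => ?_) (fun a _ ha => ?_) (show Commute _ g from hg.symm)
    · obtain ⟨i, hi, rfl⟩ := List.getElem_of_mem hw
      refine ⟨zs[i]'(hlen ▸ hi), hz i hi (hlen ▸ hi), Subgroup.subset_closure ⟨_, ?_, rfl⟩⟩
      exact List.mem_append_left _ (List.getElem_mem _)
    · refine Subgroup.subset_closure ⟨[(a, true)], List.mem_append_right _ ?_, rfl⟩
      exact List.mem_map.2 ⟨a, (hgs a).2 ha, rfl⟩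

/-! ### Borders and primitive roots -/

/-- The prefix of length `q` of the sequence `s` has a proper border of length `k`. -/
def IsBorder (s : ℕ → ℕ) (q k : ℕ) : Prop := k < q ∧ ∀ i < k, s i = s (q - k + i)

/-- The longest proper border of the prefix of length `q` has length `k`. -/
def IsMaxBorder (s : ℕ → ℕ) (q k : ℕ) : Prop := IsBorder s q k ∧ ∀ j, IsBorder s q j → j ≤ k

theorem isMaxBorder_one (s : ℕ → ℕ) : IsMaxBorder s 1 0 :=
  ⟨⟨one_pos, by simp⟩, fun _ h => Nat.lt_succ_iff.1 h.1⟩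

theorem IsBorder.trans {s : ℕ → ℕ} {q k j : ℕ} (h : IsBorder s q k) (h' : IsBorder s k j) :
    IsBorder s q j := by
  refine ⟨h'.1.trans h.1, fun i hi => ?_⟩
  have h1 := h.1
  have h2 := h'.1
  rw [h'.2 i hi, h.2 (k - j + i) (by omega)]
  congr 1; omega

/-- The borders of a prefix form a chain, so the next shorter border after one of length k is the
longest border of the prefix of length k. -/
theorem IsBorder.of_lt {s : ℕ → ℕ} {q k j : ℕ} (h : IsBorder s q k) (h' : IsBorder s q j)
    (hjk : j < k) : IsBorder s k j := by
  refine ⟨hjk, fun i hi => ?_⟩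
  have h1 := h.1
  rw [h'.2 i hi, h.2 (k - j + i) (by omega)]
  congr 1; omega

theorem IsBorder.pred {s : ℕ → ℕ} {q j : ℕ} (h : IsBorder s (q + 1) (j + 1)) :
    IsBorder s q j ∧ s j = s q := by
  have h1 := h.1
  refine ⟨⟨by omega, fun i hi => ?_⟩, ?_⟩
  · rw [h.2 i (by omega)]; congr 1; omega
  · rw [h.2 j (by omega)]; congr 1; omega

theorem IsBorder.succ {s : ℕ → ℕ} {q j : ℕ} (h : IsBorder s q j) (h' : s j = s q) :
    IsBorder s (q + 1) (j + 1) := by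
  have h1 := h.1
  refine ⟨by omega, fun i hi => ?_⟩
  rcases Nat.lt_succ_iff_lt_or_eq.1 hi with hi | rfl
  · rw [h.2 i hi]; congr 1; omega
  · rw [h']; congr 1; omega

/-- All borders of the prefix of length `q + 1` extend borders of length at most `k` of the prefix
of length `q`, and there is one of length `k`. -/
def IsCandidate (s : ℕ → ℕ) (q k : ℕ) : Prop :=
  IsBorder s q k ∧ ∀ j, IsBorder s (q + 1) j → j ≤ k + 1

theorem IsMaxBorder.isCandidate {s : ℕ → ℕ} {q k : ℕ} (h : IsMaxBorder s q k) :
    IsCandidate s q k := by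
  refine ⟨h.1, fun j hj => ?_⟩
  rcases j with _ | j
  · omega
  · have := h.2 j hj.pred.1
    omega

theorem IsCandidate.match {s : ℕ → ℕ} {q k : ℕ} (h : IsCandidate s q k) (e : s k = s q) :
    IsMaxBorder s (q + 1) (k + 1) := ⟨h.1.succ e, h.2⟩

theorem IsCandidate.zero {s : ℕ → ℕ} {q : ℕ} (h : IsCandidate s q 0) (e : s 0 ≠ s q) :
    IsMaxBorder s (q + 1) 0 := by
  refine ⟨⟨by omega, by simp⟩, fun j hj => ?_⟩
  rcases j with _ | j
  · omega
  · have := h.2 _ hj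
    obtain rfl : j = 0 := by omega
    exact absurd hj.pred.2 e

/-- The mismatch excludes an extension of the border k. Any other extendable border is shorter,
hence a border of the prefix of length k and no longer than k'. -/
theorem IsCandidate.fallback {s : ℕ → ℕ} {q k k' : ℕ} (h : IsCandidate s q k) (e : s k ≠ s q)
    (hk : IsMaxBorder s k k') : IsCandidate s q k' := by
  refine ⟨h.1.trans hk.1, fun j hj => ?_⟩
  rcases j with _ | j
  · omega
  · have h1 := h.2 _ hj
    have h2 := hj.pred
    have h3 : j ≠ k := by rintro rfl; exact e h2.2
    have := hk.2 j (h.1.of_lt h2.1 (by omega))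
    omega

/-! ### Periods and powers -/

theorem eq_mod_of_period {s : ℕ → ℕ} {n d : ℕ} (hd : ∀ i, i + d < n → s i = s (i + d)) (m : ℕ)
    (hm : m < n) : s m = s (m % d) := by
  induction m using Nat.strong_induction_on with
  | _ m ih =>
    rcases lt_or_ge m d with h | h
    · rw [Nat.mod_eq_of_lt h]
    · rcases Nat.eq_zero_or_pos d with rfl | hd0
      · simp
      obtain ⟨i, rfl⟩ := Nat.exists_eq_add_of_le h
      rw [Nat.add_comm, ← hd i (by omega), ih i (by omega) (by omega), Nat.add_mod_right]

/-- A sequence of length `n` with periods `p` and `d`, where `d` divides `n`, and `p + d ≤ n`, has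
period `gcd p d`. -/
theorem period_gcd {s : ℕ → ℕ} {n p d : ℕ} (hd0 : 0 < d) (hpd : p + d ≤ n)
    (hp : ∀ i, i + p < n → s i = s (i + p)) (hd : ∀ i, i + d < n → s i = s (i + d)) (i : ℕ)
    (hi : i + p.gcd d < n) : s i = s (i + p.gcd d) := by
  -- Extend the first d values d-periodically to the integers. Since p + d ≤ n, the period p can be
  -- checked on residues below d without leaving the range of s. Bézout then gives the period gcd.
  let f : ℤ → ℕ := fun i => s (i % d).toNat
  have hf : ∀ m : ℕ, m < n → f m = s m := fun m hm => by
    rw [eq_mod_of_period hd m hm]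
    simp only [f]
    congr 1
  have hfd : Function.Periodic f d := fun i => by simp [f]
  have hfp : Function.Periodic f p := fun i => by
    have h1 : 0 ≤ i % d := Int.emod_nonneg _ (by omega)
    have h2 : i % d < d := Int.emod_lt_of_pos _ (by omega)
    obtain ⟨j, hj⟩ := Int.eq_ofNat_of_zero_le h1
    have h3 : f (i + p) = f ((j + p : ℕ) : ℤ) := by
      simp only [f]
      rw [← Int.emod_add_emod, hj]
      push_cast
      rfl
    have h4 : f i = f (j : ℤ) := by
      simp only [f]
      rw [← hj, Int.emod_emod]
    rw [h3, h4, hf _ (by omega), hf _ (by omega), hp j (by omega)]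
  have hg : Function.Periodic f (p.gcd d : ℕ) := by
    rw [Nat.gcd_eq_gcd_ab]
    have h1 : Function.Periodic f (p.gcdA d * p) := hfp.int_mul (p.gcdA d)
    have h2 : Function.Periodic f (p.gcdB d * d) := hfd.int_mul (p.gcdB d)
    intro x
    rw [← add_assoc, mul_comm (d : ℤ), mul_comm (p : ℤ), h2, h1]
  rw [← hf i (by omega), ← hf _ hi]
  push_cast
  exact (hg i).symm

/-- The codes of the letters of a word. -/
def letterAt (w : Word N) (i : ℕ) : ℕ := (w.map letterCode).getD i 0

theorem letterCode_injective : Function.Injective (letterCode (N := N)) := by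
  rintro ⟨a, ε⟩ ⟨b, δ⟩ h
  simp only [letterCode] at h
  have hab : a = b := by
    apply Fin.ext
    split_ifs at h <;> omega
  subst hab
  cases ε <;> cases δ <;> simp_all

theorem letterAt_eq {w : Word N} {i : ℕ} (hi : i < w.length) : letterAt w i = letterCode w[i] := by
  simp [letterAt, hi]

theorem letterAt_eq_iff {w : Word N} {i j : ℕ} (hi : i < w.length) (hj : j < w.length) :
    letterAt w i = letterAt w j ↔ w[i]? = w[j]? := by
  rw [letterAt_eq hi, letterAt_eq hj, letterCode_injective.eq_iff, List.getElem?_eq_getElem hi,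
    List.getElem?_eq_getElem hj, Option.some_inj]

theorem wordPow_period (z : Word N) (r i : ℕ) (hi : i + z.length < (wordPow z r).length) :
    (wordPow z r)[i]? = (wordPow z r)[i + z.length]? := by
  rcases r with _ | r
  · simp [wordPow_zero] at hi
  · have h1 : i < (wordPow z r).length := by
      rw [length_wordPow] at hi ⊢
      rw [Nat.succ_mul] at hi
      omega
    conv_lhs => rw [wordPow_succ', List.getElem?_append_left h1]
    rw [wordPow_succ, List.getElem?_append_right (by omega), Nat.add_sub_cancel]

theorem eq_wordPow_of_period {w : Word N} {p r : ℕ} (hl : w.length = r * p)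
    (h : ∀ i, i + p < w.length → w[i]? = w[i + p]?) : w = wordPow (w.take p) r := by
  induction r generalizing w with
  | zero => simpa [wordPow_zero] using hl
  | succ r ih =>
    rw [Nat.succ_mul] at hl
    have h1 := ih (w := w.drop p) (by simp [hl]) (fun i hi => by
      rw [List.length_drop] at hi
      rw [List.getElem?_drop, List.getElem?_drop, h (p + i) (by omega), add_assoc])
    rcases r with _ | r
    · rw [wordPow_one, List.take_of_length_le (by omega)]
    · have h2 : (w.drop p).take p = w.take p := by
        rw [Nat.succ_mul] at hl
        refine List.ext_getElem? fun i => ?_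
        rw [List.getElem?_take, List.getElem?_take, List.getElem?_drop]
        split_ifs with hi
        · rw [h i (by omega), add_comm]
        · rfl
      rw [h2] at h1
      rw [wordPow_succ, ← h1, List.take_append_drop]

/-- The root length computed from the length `n` of a word and its longest proper border. -/
def rootLength (n k : ℕ) : ℕ := if n - k ∣ n then n - k else n

/-- Borders of length k correspond to periods n - k, so the longest one gives the smallest period p.
A base of any proper power has a period as its length: if p divides n, then p is the shortest base,
and otherwise there is no proper power. -/
theorem isWordRoot_take {w : Word N} {k : ℕ} (hk : IsMaxBorder (letterAt w) w.length k) :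
    IsWordRoot w (w.take (rootLength w.length k)) := by
  have hkn := hk.1.1
  set n := w.length with hn
  set p := n - k with hp
  have hperp : ∀ i, i + p < n → letterAt w i = letterAt w (i + p) := fun i hi => by
    rw [hk.1.2 i (by omega), add_comm]
  have hle : ∀ d, 0 < d → d < n → (∀ i, i + d < n → letterAt w i = letterAt w (i + d)) → p ≤ d := by
    intro d hd0 hd h
    have := hk.2 (n - d) ⟨by omega, fun i hi => by
      rw [h i (by omega)]; congr 1; omega⟩
    omega
  have hpow : ∀ (z : Word N) (r : ℕ), w = wordPow z r → 2 ≤ r → 0 < z.length ∧ n = r * z.length ∧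
      (∀ i, i + z.length < n → letterAt w i = letterAt w (i + z.length)) := by
    intro z r hz hr
    have hl : n = r * z.length := by rw [hn, hz, length_wordPow]
    refine ⟨Nat.pos_of_ne_zero fun h0 => by rw [h0] at hl; omega, hl, fun i hi => ?_⟩
    rw [letterAt_eq_iff (by omega) (by omega), hz]
    exact wordPow_period z r i (by rw [← hz]; exact hi)
  rw [rootLength]
  split_ifs with hdvd
  · obtain ⟨r, hr⟩ := hdvd
    refine ⟨r, eq_wordPow_of_period (by rw [mul_comm]; exact hr) fun i hi => ?_, fun z' r' h' => ?_⟩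
    · exact (letterAt_eq_iff (by omega) hi).1 (hperp i hi)
    · have hr0 : r ≠ 0 := by rintro rfl; omega
      rcases Nat.lt_or_ge r' 2 with h2 | h2
      · omega
      obtain ⟨hz0, hl, hper⟩ := hpow z' r' h' h2
      have h3 := hle _ hz0 (by nlinarith) hper
      by_contra hc
      have : r * p < r' * z'.length := by
        calc r * p < r' * p := Nat.mul_lt_mul_of_pos_right (by omega) (by omega)
          _ ≤ _ := Nat.mul_le_mul_left _ h3
      rw [mul_comm r p, ← hr, ← hl] at this
      exact lt_irrefl _ this
  · rw [hn, List.take_length]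
    refine ⟨1, (wordPow_one w).symm, fun z' r' h' => ?_⟩
    by_contra hc
    obtain ⟨hz0, hl, hper⟩ := hpow z' r' h' (by omega)
    -- A proper power has its base length as a period of at most n / 2. Together with p this leaves
    -- room for the gcd of the two periods, and minimality of p forces p to divide the base length
    -- and so n.
    have h2 : 2 * z'.length ≤ n := by rw [hl]; exact Nat.mul_le_mul_right _ (by omega)
    have h3 := hle _ hz0 (by omega) hper
    have hg := period_gcd hz0 (by omega) hperp hper
    have hgle := Nat.gcd_le_left z'.length (show 0 < p by omega)
    have h4 := hle _ (Nat.gcd_pos_of_pos_right _ hz0) (by omega) hg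
    have h5 : p ∣ z'.length := by
      have := Nat.gcd_dvd_right p z'.length
      rwa [le_antisymm hgle h4] at this
    exact hdvd ((h5.mul_left r').trans hl.symm.dvd)

end RAAG

namespace RAM

/-! ### Reasoning about programs -/

/-- All registers hold numbers of size at most `B`. -/
def Bdd (B : ℕ) (m : ℕ → ℕ) : Prop := ∀ r, m r ≤ B

theorem Bdd.update {B : ℕ} {m : ℕ → ℕ} (h : Bdd B m) (a : ℕ) {v : ℕ} (hv : v ≤ B) :
    Bdd B (Function.update m a v) := fun r => by
  rw [Function.update_apply]
  split_ifs
  · exact hv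
  · exact h r

/-- The program leads from one configuration to another within `T` steps, with all registers
bounded by `B` on the way. -/
inductive Reach (P : Program) (B : ℕ) : ℕ → Config → Config → Prop
  | refl {T : ℕ} {c : Config} (hb : Bdd B c.mem) : Reach P B T c c
  | head {T : ℕ} {c c' d : Config} (hb : Bdd B c.mem) (hs : step P c = some c')
      (h : Reach P B T c' d) : Reach P B (T + 1) c d

variable {P : Program} {B T T' pc : ℕ} {m : ℕ → ℕ} {i o : List ℕ} {c d e : Config}

theorem Reach.mono (h : Reach P B T c d) (hT : T ≤ T') : Reach P B T' c d := by
  induction h generalizing T' with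
  | refl hb => exact .refl hb
  | head hb hs _ ih =>
    obtain ⟨T', rfl⟩ := Nat.exists_eq_add_of_le' (Nat.one_le_of_lt hT)
    exact .head hb hs (ih (by omega))

theorem Reach.trans (h : Reach P B T c d) (h' : Reach P B T' d e) : Reach P B (T + T') c e := by
  induction h with
  | refl hb => exact h'.mono (by omega)
  | head hb hs _ ih => exact (Reach.head hb hs (ih h')).mono (by omega)

theorem Reach.bdd (h : Reach P B T c ⟨pc, m, i, o⟩) : Bdd B m := by
  generalize hd : Config.mk pc m i o = d at h
  induction h with
  | refl hb => subst hd; exact hb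
  | head _ _ _ ih => exact ih hd

/-- The machine is deterministic, so every run from the initial configuration is a segment of the
one that halts. Bounds along that run therefore hold at all times. -/
theorem Reach.computesWithin {inp : List ℕ} (h : Reach P B T (init inp) d) (hd : step P d = none) :
    ComputesWithin P inp d.output T B := by
  have key : ∀ {T : ℕ} {c d : Config}, Reach P B T c d → step P d = none →
      (∃ t ≤ T, Run P t c d) ∧ ∀ t c', Run P t c c' → Bdd B c'.mem := by
    intro T c d h
    induction h with
    | refl hb =>
      refine fun hd => ⟨⟨0, Nat.zero_le _, rfl⟩, fun t c' hr => ?_⟩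
      rcases t with _ | t
      · rw [← show _ = c' from hr]; exact hb
      · obtain ⟨c'', h1, -⟩ := hr
        rw [hd] at h1
        simp at h1
    | head hb hs _ ih =>
      intro hd
      obtain ⟨⟨t, ht, hr⟩, h2⟩ := ih hd
      refine ⟨⟨t + 1, by omega, _, hs, hr⟩, fun t c' hr => ?_⟩
      rcases t with _ | t
      · rw [← show _ = c' from hr]; exact hb
      · obtain ⟨c'', h1, h3⟩ := hr
        rw [hs, Option.some_inj] at h1
        subst h1
        exact h2 t c' h3
  obtain ⟨⟨t, ht, hr⟩, h2⟩ := key h hd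
  exact ⟨⟨t, ht, d, hr, hd, rfl⟩, h2⟩

theorem val_imm {n : ℕ} : (Config.mk pc m i o).val (.imm n) = n := rfl

theorem val_reg {r u : ℕ} (h : m r = u) : (Config.mk pc m i o).val (.reg r) = u := h

theorem val_ind {r a u : ℕ} (h : m r = a) (h' : m a = u) :
    (Config.mk pc m i o).val (.ind r) = u := by subst h; exact h'

theorem addr_reg {r : ℕ} : (Config.mk pc m i o).addr (.reg r) = r := rfl

theorem addr_ind {r a : ℕ} (h : m r = a) : (Config.mk pc m i o).addr (.ind r) = a := h

/-- Rules of this kind prefix one instruction to a known run. Addresses and operands enter through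
equations, so nested updates can be simplified locally, and the continuation receives the bound for
the new memory. -/
theorem Reach.mov {t : Target} {x : Source} {a u : ℕ} (hP : P[pc]? = some (.mov t x))
    (hb : Bdd B m) (ha : (Config.mk pc m i o).addr t = a) (hx : (Config.mk pc m i o).val x = u)
    (hu : u ≤ B)
    (h : Bdd B (Function.update m a u) → Reach P B T ⟨pc + 1, Function.update m a u, i, o⟩ e) :
    Reach P B (T + 1) ⟨pc, m, i, o⟩ e := by
  subst ha hx
  exact .head hb (by rw [step, hP]; rfl) (h (hb.update _ hu))

theorem Reach.add {t : Target} {x y : Source} {a u v : ℕ} (hP : P[pc]? = some (.add t x y))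
    (hb : Bdd B m) (ha : (Config.mk pc m i o).addr t = a) (hx : (Config.mk pc m i o).val x = u)
    (hy : (Config.mk pc m i o).val y = v) (hu : u + v ≤ B)
    (h : Bdd B (Function.update m a (u + v)) →
      Reach P B T ⟨pc + 1, Function.update m a (u + v), i, o⟩ e) :
    Reach P B (T + 1) ⟨pc, m, i, o⟩ e := by
  subst ha hx hy
  exact .head hb (by rw [step, hP]; rfl) (h (hb.update _ hu))

theorem Reach.sub {t : Target} {x y : Source} {a u v : ℕ} (hP : P[pc]? = some (.sub t x y))
    (hb : Bdd B m) (ha : (Config.mk pc m i o).addr t = a) (hx : (Config.mk pc m i o).val x = u)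
    (hy : (Config.mk pc m i o).val y = v) (hu : u - v ≤ B)
    (h : Bdd B (Function.update m a (u - v)) →
      Reach P B T ⟨pc + 1, Function.update m a (u - v), i, o⟩ e) :
    Reach P B (T + 1) ⟨pc, m, i, o⟩ e := by
  subst ha hx hy
  exact .head hb (by rw [step, hP]; rfl) (h (hb.update _ hu))

theorem Reach.jz {x : Source} {u k : ℕ} (hP : P[pc]? = some (.jz x k)) (hb : Bdd B m)
    (hx : (Config.mk pc m i o).val x = u) (hu : u = 0) (h : Reach P B T ⟨k, m, i, o⟩ e) :
    Reach P B (T + 1) ⟨pc, m, i, o⟩ e := by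
  refine .head hb ?_ h
  rw [step, hP]
  simp only [Option.bind_some, exec, hx, hu, if_true]

theorem Reach.jz_of_ne {x : Source} {u k : ℕ} (hP : P[pc]? = some (.jz x k)) (hb : Bdd B m)
    (hx : (Config.mk pc m i o).val x = u) (hu : u ≠ 0) (h : Reach P B T ⟨pc + 1, m, i, o⟩ e) :
    Reach P B (T + 1) ⟨pc, m, i, o⟩ e := by
  refine .head hb ?_ h
  rw [step, hP]
  simp only [Option.bind_some, exec, hx, hu, if_false]

theorem Reach.jump {k : ℕ} (hP : P[pc]? = some (.jz (.imm 0) k)) (hb : Bdd B m)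
    (h : Reach P B T ⟨k, m, i, o⟩ e) : Reach P B (T + 1) ⟨pc, m, i, o⟩ e :=
  .jz hP hb rfl rfl h

theorem Reach.read {t : Target} {a x : ℕ} (hP : P[pc]? = some (.read t)) (hb : Bdd B m)
    (ha : (Config.mk pc m (x :: i) o).addr t = a) (hu : x ≤ B)
    (h : Bdd B (Function.update m a x) → Reach P B T ⟨pc + 1, Function.update m a x, i, o⟩ e) :
    Reach P B (T + 1) ⟨pc, m, x :: i, o⟩ e := by
  subst ha
  exact .head hb (by rw [step, hP]; rfl) (h (hb.update _ hu))

theorem Reach.write {x : Source} {u : ℕ} (hP : P[pc]? = some (.write x)) (hb : Bdd B m)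
    (hx : (Config.mk pc m i o).val x = u) (h : Reach P B T ⟨pc + 1, m, i, o ++ [u]⟩ e) :
    Reach P B (T + 1) ⟨pc, m, i, o⟩ e := by
  subst hx
  exact .head hb (by rw [step, hP]; rfl) h

end RAM

namespace RAAG

open RAM

/-! ### The program -/

/-- Reading the words and writing their roots. Registers below `D` flag the letters that have been
read. The letters of the current word are stored in the registers `D + 6 + 2 * i`, and pointers to
the longest borders of its prefixes in the registers `D + 7 + 2 * i`. -/
def rootProgram (D : ℕ) : Program :=
  [ -- read the first letter of the next word
    .read (.reg (D + 2)),
    .jz (.reg (D + 2)) 43,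
    .mov (.reg D) (.imm (D + 6)),
    .mov (.ind D) (.reg (D + 2)),
    .mov (.ind (D + 2)) (.imm 1),
    .mov (.reg (D + 1)) (.imm (D + 6)),
    .jz (.imm 0) 22,
    -- 7: read the next letter
    .read (.reg (D + 2)),
    -- Letter codes are at least 2, so the result vanishes at the separator 1 but at no letter.
    .sub (.reg (D + 3)) (.reg (D + 2)) (.imm 1),
    .jz (.reg (D + 3)) 26,
    .mov (.ind D) (.reg (D + 2)),
    .mov (.ind (D + 2)) (.imm 1),
    -- 12: compare it with the letter after the current border
    .sub (.reg (D + 3)) (.ind (D + 1)) (.reg (D + 2)),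
    .sub (.reg (D + 4)) (.reg (D + 2)) (.ind (D + 1)),
    -- The sum of both truncated differences is zero exactly when the letters agree.
    .add (.reg (D + 3)) (.reg (D + 3)) (.reg (D + 4)),
    .jz (.reg (D + 3)) 21,
    .sub (.reg (D + 3)) (.reg (D + 1)) (.imm (D + 6)),
    .jz (.reg (D + 3)) 22,
    .add (.reg (D + 5)) (.reg (D + 1)) (.imm 1),
    .mov (.reg (D + 1)) (.ind (D + 5)),
    .jz (.imm 0) 12,
    -- 21: extend the border
    .add (.reg (D + 1)) (.reg (D + 1)) (.imm 2),
    -- 22: record the border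
    .add (.reg D) (.reg D) (.imm 2),
    .add (.reg (D + 5)) (.reg D) (.imm 1),
    .mov (.ind (D + 5)) (.reg (D + 1)),
    .jz (.imm 0) 7,
    -- 26: end of the word; test whether its smallest period divides its length
    .sub (.reg (D + 3)) (.reg D) (.reg (D + 1)),
    .sub (.reg (D + 4)) (.reg D) (.imm (D + 6)),
    .jz (.reg (D + 4)) 35,
    .sub (.reg (D + 5)) (.reg (D + 3)) (.reg (D + 4)),
    .jz (.reg (D + 5)) 33,
    -- A nonzero remainder below the period is left, so the period does not divide the length and is
    -- replaced by the whole length. Lengths are held doubled, like the pointer distances.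
    .sub (.reg (D + 3)) (.reg D) (.imm (D + 6)),
    .jz (.imm 0) 35,
    .sub (.reg (D + 4)) (.reg (D + 4)) (.reg (D + 3)),
    .jz (.imm 0) 28,
    -- 35: write the root
    .mov (.reg (D + 5)) (.imm (D + 6)),
    .jz (.reg (D + 3)) 41,
    .write (.ind (D + 5)),
    .add (.reg (D + 5)) (.reg (D + 5)) (.imm 2),
    .sub (.reg (D + 3)) (.reg (D + 3)) (.imm 2),
    .jz (.imm 0) 36,
    .write (.imm 1),
    .jz (.imm 0) 0 ]

/-- The program begins with `rootProgram D`. -/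
def StartsWith (P : Program) (D : ℕ) : Prop := ∀ j < 43, P[j]? = (rootProgram D)[j]?

/-- The contents of the registers after reading `q` letters of a word with a border of
length `k`; the letters in `L` have been flagged. -/
structure Stored (D : ℕ) (s : ℕ → ℕ) (L : List ℕ) (q k : ℕ) (m : ℕ → ℕ) : Prop where
  pos : m D = D + 6 + 2 * q
  border : m (D + 1) = D + 6 + 2 * k
  letter : ∀ j < q, m (D + 6 + 2 * j) = s j
  failure : ∀ j, 1 ≤ j → j ≤ q → ∃ b, IsMaxBorder s j b ∧ m (D + 7 + 2 * j) = D + 6 + 2 * b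
  flag : ∀ c, 2 ≤ c → c < D → m c = if c ∈ L then 1 else 0

variable {P : Program} {B D : ℕ} {m s : ℕ → ℕ} {i o L : List ℕ} {q k : ℕ}

/-- A change of the registers outside the stored data. -/
theorem Stored.congr {m' : ℕ → ℕ} (h : Stored D s L q k m)
    (h' : ∀ r, r ≠ D + 2 → r ≠ D + 3 → r ≠ D + 4 → r ≠ D + 5 → m' r = m r) :
    Stored D s L q k m' where
  pos := by rw [h' _ (by omega) (by omega) (by omega) (by omega), h.pos]
  border := by rw [h' _ (by omega) (by omega) (by omega) (by omega), h.border]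
  letter j hj := by rw [h' _ (by omega) (by omega) (by omega) (by omega), h.letter j hj]
  failure j hj hj' := by
    obtain ⟨b, hb, e⟩ := h.failure j hj hj'
    exact ⟨b, hb, by rw [h' _ (by omega) (by omega) (by omega) (by omega), e]⟩
  flag c hc hc' := by rw [h' _ (by omega) (by omega) (by omega) (by omega), h.flag c hc hc']

/-- A change of the border pointer. -/
theorem Stored.update_border (h : Stored D s L q k m) (k' : ℕ) :
    Stored D s L q k' (Function.update m (D + 1) (D + 6 + 2 * k')) where
  pos := by rw [Function.update_of_ne (by omega), h.pos]
  border := by rw [Function.update_self]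
  letter j hj := by rw [Function.update_of_ne (by omega), h.letter j hj]
  failure j hj hj' := by
    obtain ⟨b, hb, e⟩ := h.failure j hj hj'
    exact ⟨b, hb, by rw [Function.update_of_ne (by omega), e]⟩
  flag c hc hc' := by rw [Function.update_of_ne (by omega), h.flag c hc hc']

/-- The current border is replaced by shorter ones until it can be extended. -/
theorem compare_loop (hP : StartsWith P D) (hq : D + 2 * q + 20 ≤ B) (hm : Bdd B m)
    (hS : Stored D s L q k m) (hlast : m (D + 6 + 2 * q) = s q) (hcur : m (D + 2) = s q)
    (hk : IsCandidate s q k) :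
    ∃ k' m', k' ≤ k + 1 ∧ IsMaxBorder s (q + 1) k' ∧ Stored D s L q k' m' ∧
      m' (D + 6 + 2 * q) = s q ∧
      Reach P B (9 * (k + 1 - k') + 6) ⟨12, m, i, o⟩ ⟨22, m', i, o⟩ := by
  -- A fallback takes 9 steps and shortens the border by at least one, so its cost is paid by the
  -- decrease of the border length. The last comparison takes at most 6 steps.
  induction k using Nat.strong_induction_on generalizing m with
  | _ k ih =>
    have hkq := hk.1.1
    have hsq : s q ≤ B := hlast ▸ hm _
    have hsk : m (D + 6 + 2 * k) = s k := hS.letter k hkq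
    have hskB : s k ≤ B := hsk ▸ hm _
    have hbd := hS.border
    obtain ⟨m₁, hR₁, h1, h1'⟩ : ∃ m₁, Reach P B 3 ⟨12, m, i, o⟩ ⟨15, m₁, i, o⟩ ∧
        m₁ (D + 3) = (s k - s q) + (s q - s k) ∧ ∀ r, r ≠ D + 3 → r ≠ D + 4 → m₁ r = m r := by
      refine ⟨_, .sub (hP 12 (by norm_num)) hm addr_reg (val_ind hbd hsk) (val_reg hcur) (by omega)
        fun hb => .sub (hP 13 (by norm_num)) hb addr_reg
          (val_reg (by rw [Function.update_of_ne (by omega), hcur]))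
          (val_ind (by rw [Function.update_of_ne (by omega), hbd])
            (by rw [Function.update_of_ne (by omega), hsk])) (by omega)
        fun hb => .add (hP 14 (by norm_num)) hb addr_reg
          (val_reg (by rw [Function.update_of_ne (by omega), Function.update_self]))
          (val_reg (Function.update_self ..)) (by omega) fun hb => .refl hb,
        ?_, fun r hr hr' => ?_⟩
      · rw [Function.update_self]
      · rw [Function.update_of_ne hr, Function.update_of_ne hr', Function.update_of_ne hr]
    have hS₁ : Stored D s L q k m₁ := hS.congr fun r _ h h' _ => h1' r h h'
    have hl₁ : m₁ (D + 6 + 2 * q) = s q := by rw [h1' _ (by omega) (by omega), hlast]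
    have hc₁ : m₁ (D + 2) = s q := by rw [h1' _ (by omega) (by omega), hcur]
    by_cases hne : s k = s q
    · refine ⟨k + 1, Function.update m₁ (D + 1) (D + 6 + 2 * k + 2), le_rfl, hk.match hne,
        hS₁.update_border (k + 1), by rw [Function.update_of_ne (by omega), hl₁],
        (hR₁.trans (T' := 2) ?_).mono (by omega)⟩
      exact .jz (hP 15 (by norm_num)) hR₁.bdd (val_reg h1) (by omega)
        (.add (hP 21 (by norm_num)) hR₁.bdd addr_reg (val_reg hS₁.border) val_imm (by omega)
          fun hb => .refl hb)
    obtain ⟨m₂, hR₂, h2, h2'⟩ : ∃ m₂, Reach P B 2 ⟨15, m₁, i, o⟩ ⟨17, m₂, i, o⟩ ∧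
        m₂ (D + 3) = D + 6 + 2 * k - (D + 6) ∧ ∀ r, r ≠ D + 3 → m₂ r = m₁ r :=
      ⟨_, .jz_of_ne (hP 15 (by norm_num)) hR₁.bdd (val_reg h1) (by omega)
        (.sub (hP 16 (by norm_num)) hR₁.bdd addr_reg (val_reg hS₁.border) val_imm (by omega)
          fun hb => .refl hb), Function.update_self .., fun r hr => Function.update_of_ne hr ..⟩
    have hS₂ : Stored D s L q k m₂ := hS₁.congr fun r _ h _ _ => h2' r h
    have hl₂ : m₂ (D + 6 + 2 * q) = s q := by rw [h2' _ (by omega), hl₁]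
    have hc₂ : m₂ (D + 2) = s q := by rw [h2' _ (by omega), hc₁]
    rcases Nat.eq_zero_or_pos k with rfl | hk0
    · refine ⟨0, m₂, by omega, hk.zero hne, hS₂, hl₂,
        ((hR₁.trans hR₂).trans (T' := 1) ?_).mono (by omega)⟩
      exact .jz (hP 17 (by norm_num)) hR₂.bdd (val_reg h2) (by omega) (.refl hR₂.bdd)
    · obtain ⟨k₁, hk₁, e₁⟩ := hS₂.failure k hk0 hkq.le
      have hk₁k := hk₁.1.1
      set m₃ := Function.update m₂ (D + 5) (D + 6 + 2 * k + 1) with hm₃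
      have hS₃ : Stored D s L q k m₃ := hS₂.congr fun r _ _ _ h => Function.update_of_ne h ..
      have hR₃ : Reach P B 4 ⟨17, m₂, i, o⟩
          ⟨12, Function.update m₃ (D + 1) (D + 6 + 2 * k₁), i, o⟩ :=
        .jz_of_ne (hP 17 (by norm_num)) hR₂.bdd (val_reg h2) (by omega)
          (.add (hP 18 (by norm_num)) hR₂.bdd addr_reg (val_reg hS₂.border) val_imm
          (by omega) fun hb => .mov (hP 19 (by norm_num)) hb addr_reg
          (val_ind (a := D + 6 + 2 * k + 1) (u := D + 6 + 2 * k₁) (Function.update_self ..)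
            (by rw [Function.update_of_ne (by omega), ← e₁]; congr 1; omega)) (by omega)
          fun hb => .jump (hP 20 (by norm_num)) hb (.refl hb))
      obtain ⟨k', m', hk', hb', hS', hl', hR'⟩ := ih k₁ hk₁k hR₃.bdd (hS₃.update_border k₁)
        (by rw [Function.update_of_ne (by omega), hm₃, Function.update_of_ne (by omega), hl₂])
        (by rw [Function.update_of_ne (by omega), hm₃, Function.update_of_ne (by omega), hc₂])
        (hk.fallback hne hk₁)
      exact ⟨k', m', by omega, hb', hS', hl',
        (((hR₁.trans hR₂).trans hR₃).trans hR').mono (by omega)⟩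

/-- Storing and flagging the next letter. -/
theorem Stored.store (h : Stored D s L q k m) (hs : s q < D) :
    Stored D s (L ++ [s q]) q k
      (Function.update (Function.update m (D + 6 + 2 * q) (s q)) (s q) 1) where
  pos := by rw [Function.update_of_ne (by omega), Function.update_of_ne (by omega), h.pos]
  border := by rw [Function.update_of_ne (by omega), Function.update_of_ne (by omega), h.border]
  letter j hj := by
    rw [Function.update_of_ne (by omega), Function.update_of_ne (by omega), h.letter j hj]
  failure j hj hj' := by
    obtain ⟨b, hb, e⟩ := h.failure j hj hj'
    exact ⟨b, hb, by rw [Function.update_of_ne (by omega), Function.update_of_ne (by omega), e]⟩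
  flag c hc hc' := by
    by_cases hcs : c = s q
    · rw [hcs, Function.update_self]; simp
    · rw [Function.update_of_ne hcs, Function.update_of_ne (by omega), h.flag c hc hc']
      simp [hcs]

/-- Recording the longest border of the word read so far. -/
theorem Stored.record (h : Stored D s L q k m) (hl : m (D + 6 + 2 * q) = s q)
    (hk : IsMaxBorder s (q + 1) k) {x : ℕ} :
    Stored D s L (q + 1) k (Function.update (Function.update (Function.update m D
      (D + 6 + 2 * q + 2)) (D + 5) x) (D + 6 + 2 * q + 2 + 1) (D + 6 + 2 * k)) where
  pos := by
    rw [Function.update_of_ne (by omega), Function.update_of_ne (by omega), Function.update_self]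
    ring
  border := by
    rw [Function.update_of_ne (by omega), Function.update_of_ne (by omega),
      Function.update_of_ne (by omega), h.border]
  letter j hj := by
    rw [Function.update_of_ne (by omega), Function.update_of_ne (by omega),
      Function.update_of_ne (by omega)]
    rcases Nat.lt_succ_iff_lt_or_eq.1 hj with hj | rfl
    · exact h.letter j hj
    · exact hl
  failure j hj hj' := by
    rcases Nat.le_succ_iff.1 hj' with hj' | rfl
    · obtain ⟨b, hb, e⟩ := h.failure j hj hj'
      exact ⟨b, hb, by rw [Function.update_of_ne (by omega), Function.update_of_ne (by omega),
        Function.update_of_ne (by omega), e]⟩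
    · refine ⟨k, hk, ?_⟩
      rw [show D + 7 + 2 * (q + 1) = D + 6 + 2 * q + 2 + 1 by ring, Function.update_self]
  flag c hc hc' := by
    rw [Function.update_of_ne (by omega), Function.update_of_ne (by omega),
      Function.update_of_ne (by omega), h.flag c hc hc']

theorem record_step (hP : StartsWith P D) (hq : D + 2 * q + 20 ≤ B) (hm : Bdd B m)
    (hS : Stored D s L q k m) (hl : m (D + 6 + 2 * q) = s q) (hk : IsMaxBorder s (q + 1) k) :
    ∃ m', Stored D s L (q + 1) k m' ∧ Reach P B 4 ⟨22, m, i, o⟩ ⟨7, m', i, o⟩ := by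
  have hkq := hk.1.1
  refine ⟨_, hS.record hl hk (x := D + 6 + 2 * q + 2 + 1), ?_⟩
  exact .add (hP 22 (by norm_num)) hm addr_reg (val_reg hS.pos) val_imm (by omega) fun hb =>
    .add (hP 23 (by norm_num)) hb addr_reg (val_reg (Function.update_self ..)) val_imm
      (by omega) fun hb =>
    .mov (hP 24 (by norm_num)) hb (addr_ind (Function.update_self ..))
      (val_reg (by rw [Function.update_of_ne (by omega), Function.update_of_ne (by omega),
        hS.border])) (by omega) fun hb =>
    .jump (hP 25 (by norm_num)) hb (.refl hb)

/-- Reading the rest of a word. -/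
theorem read_loop (hP : StartsWith P D) {n : ℕ} (hn : D + 2 * n + 20 ≤ B)
    (hs : ∀ j < n, 2 ≤ s j ∧ s j < D) (hqn : q ≤ n) (hm : Bdd B m)
    (hS : Stored D s L q k m) (hk : IsMaxBorder s q k) :
    ∃ k' m', IsMaxBorder s n k' ∧
      Stored D s (L ++ (List.range' q (n - q)).map s) n k' m' ∧
      Reach P B (9 * k + 24 * (n - q) + 3) ⟨7, m, (List.range' q (n - q)).map s ++ 1 :: i, o⟩
        ⟨26, m', i, o⟩ := by
  -- Amortization with potential 9k: a letter costs 5 + (9(k + 1 - k') + 6) + 4 steps, which is 24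
  -- plus the drop in potential. The separator costs 3.
  induction hd : n - q generalizing q k m L with
  | zero =>
    obtain rfl : q = n := by omega
    refine ⟨k, Function.update (Function.update m (D + 2) 1) (D + 3) (1 - 1), hk, ?_,
      Reach.mono (T := 3) ?_ (by omega)⟩
    · simp only [List.range'_zero, List.map_nil, List.append_nil]
      exact hS.congr fun r h h' _ _ => by
        rw [Function.update_of_ne h', Function.update_of_ne h]
    · exact .read (hP 7 (by norm_num)) hm addr_reg (by omega) fun hb =>
        .sub (hP 8 (by norm_num)) hb addr_reg (val_reg (Function.update_self ..)) val_imm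
          (by omega) fun hb =>
        .jz (hP 9 (by norm_num)) hb (val_reg (Function.update_self ..)) rfl (.refl hb)
  | succ d ih =>
    obtain ⟨hs2, hsD⟩ := hs q (by omega)
    rw [List.range'_succ, List.map_cons, List.cons_append]
    set i' := (List.range' (q + 1) d).map s ++ 1 :: i with hi'
    set m₁ := Function.update (Function.update m (D + 2) (s q)) (D + 3) (s q - 1) with hm₁
    have hS₁ : Stored D s L q k m₁ := hS.congr fun r h h' _ _ => by
      rw [hm₁, Function.update_of_ne h', Function.update_of_ne h]
    have hc₁ : m₁ (D + 2) = s q := by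
      rw [hm₁, Function.update_of_ne (by omega), Function.update_self]
    have hR₁ : Reach P B 5 ⟨7, m, s q :: i', o⟩
        ⟨12, Function.update (Function.update m₁ (D + 6 + 2 * q) (s q)) (s q) 1, i', o⟩ :=
      .read (hP 7 (by norm_num)) hm addr_reg (by omega) fun hb =>
      .sub (hP 8 (by norm_num)) hb addr_reg (val_reg (Function.update_self ..)) val_imm
        (by omega) fun hb =>
      .jz_of_ne (hP 9 (by norm_num)) hb (val_reg (Function.update_self ..)) (by omega)
      (.mov (hP 10 (by norm_num)) hb (addr_ind hS₁.pos) (val_reg hc₁) (by omega) fun hb =>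
      .mov (hP 11 (by norm_num)) hb (addr_ind (by rw [Function.update_of_ne (by omega)]; exact hc₁))
        val_imm (by omega) fun hb => .refl hb)
    obtain ⟨k₁, m₂, hk₁, hb₁, hS₂, hl₂, hR₂⟩ := compare_loop (i := i') (o := o) hP (by omega)
      hR₁.bdd (hS₁.store hsD)
      (by rw [Function.update_of_ne (by omega), Function.update_self])
      (by rw [Function.update_of_ne (by omega), Function.update_of_ne (by omega), hc₁])
      hk.isCandidate
    obtain ⟨m₃, hS₃, hR₃⟩ := record_step (i := i') (o := o) hP (by omega) hR₂.bdd hS₂ hl₂ hb₁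
    obtain ⟨k', m', hk', hS', hR'⟩ := ih (by omega) hR₃.bdd hS₃ hb₁ (by omega)
    refine ⟨k', m', hk', by simpa using hS', ?_⟩
    exact (((hR₁.trans hR₂).trans hR₃).trans hR').mono (by omega)

/-- Testing whether `p` divides `z` by repeated subtraction. -/
theorem divide_loop (hP : StartsWith P D) {n p z : ℕ} (hp : 0 < p) (hm : Bdd B m)
    (hpos : m D = D + 6 + 2 * n) (h3 : m (D + 3) = 2 * p) (h4 : m (D + 4) = 2 * z) :
    ∃ m', m' (D + 3) = 2 * (if p ∣ z then p else n) ∧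
      (∀ r, r ≠ D + 3 → r ≠ D + 4 → r ≠ D + 5 → m' r = m r) ∧
      Reach P B (5 * z + 5) ⟨28, m, i, o⟩ ⟨35, m', i, o⟩ := by
  -- A round of 5 steps lowers z by p ≥ 1, so the time is linear in z for every p.
  induction z using Nat.strong_induction_on generalizing m with
  | _ z ih =>
    have hBp := hm (D + 3)
    have hBz := hm (D + 4)
    have hBn := hm D
    rcases Nat.eq_zero_or_pos z with rfl | hz
    · refine ⟨m, by simpa using h3, fun _ _ _ _ => rfl, Reach.mono (T := 1) ?_ (by omega)⟩
      exact .jz (hP 28 (by norm_num)) hm (val_reg h4) rfl (.refl hm)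
    set m₁ := Function.update m (D + 5) (2 * p - 2 * z) with hm₁
    have hR₁ : Reach P B 2 ⟨28, m, i, o⟩ ⟨30, m₁, i, o⟩ :=
      .jz_of_ne (hP 28 (by norm_num)) hm (val_reg h4) (by omega)
        (.sub (hP 29 (by norm_num)) hm addr_reg (val_reg h3) (val_reg h4) (by omega)
          fun hb => .refl hb)
    have h5 : m₁ (D + 5) = 2 * p - 2 * z := Function.update_self ..
    have hfr : ∀ r, r ≠ D + 5 → m₁ r = m r := fun r hr => Function.update_of_ne hr ..
    rcases Nat.lt_or_ge z p with hzp | hzp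
    · have hnd : ¬ p ∣ z := Nat.not_dvd_of_pos_of_lt hz hzp
      refine ⟨Function.update m₁ (D + 3) (D + 6 + 2 * n - (D + 6)), ?_, fun r hr _ hr' => ?_,
        (hR₁.trans (T' := 3) ?_).mono (by omega)⟩
      · rw [Function.update_self, if_neg hnd]; omega
      · rw [Function.update_of_ne hr, hfr r hr']
      · exact .jz_of_ne (hP 30 (by norm_num)) hR₁.bdd (val_reg h5) (by omega)
          (.sub (hP 31 (by norm_num)) hR₁.bdd addr_reg
            (val_reg (by rw [hfr _ (by omega), hpos])) val_imm (by omega)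
            fun hb => .jump (hP 32 (by norm_num)) hb (.refl hb))
    · have hR₂ : Reach P B 3 ⟨30, m₁, i, o⟩
          ⟨28, Function.update m₁ (D + 4) (2 * z - 2 * p), i, o⟩ :=
        .jz (hP 30 (by norm_num)) hR₁.bdd (val_reg h5) (by omega)
          (.sub (hP 33 (by norm_num)) hR₁.bdd addr_reg
            (val_reg (by rw [hfr _ (by omega), h4])) (val_reg (by rw [hfr _ (by omega), h3]))
            (by omega) fun hb => .jump (hP 34 (by norm_num)) hb (.refl hb))
      obtain ⟨m', h', hfr', hR'⟩ := ih (z - p) (by omega) hR₂.bdd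
        (by rw [Function.update_of_ne (by omega), hfr _ (by omega), hpos])
        (by rw [Function.update_of_ne (by omega), hfr _ (by omega), h3])
        (by rw [Function.update_self]; omega)
      refine ⟨m', ?_, fun r hr hr' hr'' => ?_, ((hR₁.trans hR₂).trans hR').mono (by omega)⟩
      · have : p ∣ z - p ↔ p ∣ z := by
          rw [← Nat.dvd_add_left (dvd_refl p), Nat.sub_add_cancel hzp]
        rw [h']
        simp only [this]
      · rw [hfr' r hr hr' hr'', Function.update_of_ne hr', hfr r hr'']

/-- Writing `y` letters from position `t` on. -/
theorem write_loop (hP : StartsWith P D) {n t y : ℕ} (hn : D + 2 * n + 20 ≤ B) (hty : t + y ≤ n)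
    (hm : Bdd B m) (hs : ∀ j < n, m (D + 6 + 2 * j) = s j) (h3 : m (D + 3) = 2 * y)
    (h5 : m (D + 5) = D + 6 + 2 * t) :
    ∃ m', (∀ r, r ≠ D + 3 → r ≠ D + 5 → m' r = m r) ∧
      Reach P B (5 * y + 1) ⟨36, m, i, o⟩ ⟨41, m', i, o ++ (List.range' t y).map s⟩ := by
  induction y generalizing t m o with
  | zero =>
    refine ⟨m, fun _ _ _ => rfl, ?_⟩
    simp only [List.range'_zero, List.map_nil, List.append_nil]
    exact .jz (hP 36 (by norm_num)) hm (val_reg h3) rfl (.refl hm)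
  | succ y ih =>
    set m₁ := Function.update (Function.update m (D + 5) (D + 6 + 2 * t + 2)) (D + 3)
      (2 * (y + 1) - 2) with hm₁
    have hR : Reach P B 5 ⟨36, m, i, o⟩ ⟨36, m₁, i, o ++ [s t]⟩ :=
      .jz_of_ne (hP 36 (by norm_num)) hm (val_reg h3) (by omega)
        (.write (hP 37 (by norm_num)) hm (val_ind h5 (hs t (by omega)))
        (.add (hP 38 (by norm_num)) hm addr_reg (val_reg h5) val_imm (by omega) fun hb =>
        .sub (hP 39 (by norm_num)) hb addr_reg
          (val_reg (by rw [Function.update_of_ne (by omega), h3])) val_imm (by omega) fun hb =>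
        .jump (hP 40 (by norm_num)) hb (.refl hb)))
    have hfr : ∀ r, r ≠ D + 3 → r ≠ D + 5 → m₁ r = m r := fun r hr hr' => by
      rw [hm₁, Function.update_of_ne hr, Function.update_of_ne hr']
    obtain ⟨m', hfr', hR'⟩ := ih (t := t + 1) (o := o ++ [s t]) (by omega) hR.bdd
      (fun j hj => by rw [hfr _ (by omega) (by omega), hs j hj])
      (by rw [hm₁, Function.update_self]; omega)
      (by rw [hm₁, Function.update_of_ne (by omega), Function.update_self]; ring)
    refine ⟨m', fun r hr hr' => by rw [hfr' r hr hr', hfr r hr hr'], ?_⟩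
    rw [List.range'_succ, List.map_cons]
    rw [List.append_assoc, List.singleton_append] at hR'
    exact (hR.trans hR').mono (by omega)

/-- Processing one word. -/
theorem word_loop (hP : StartsWith P D) {n : ℕ} (hn : D + 2 * n + 20 ≤ B) (hn0 : 0 < n)
    (hs : ∀ j < n, 2 ≤ s j ∧ s j < D) (hm : Bdd B m)
    (hL : ∀ c, 2 ≤ c → c < D → m c = if c ∈ L then 1 else 0) :
    ∃ k m', IsMaxBorder s n k ∧
      (∀ c, 2 ≤ c → c < D → m' c = if c ∈ L ++ (List.range n).map s then 1 else 0) ∧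
      Reach P B (70 * n) ⟨0, m, (List.range n).map s ++ 1 :: i, o⟩
        ⟨0, m', i, o ++ (List.range (rootLength n k)).map s ++ [1]⟩ := by
  obtain ⟨hs2, hsD⟩ := hs 0 hn0
  obtain ⟨n, rfl⟩ := Nat.exists_eq_add_of_le' hn0
  rw [List.range_eq_range', List.range'_succ, List.map_cons, List.cons_append]
  set i' := (List.range' (0 + 1) n).map s ++ 1 :: i with hi'
  set m₁ := Function.update (Function.update (Function.update (Function.update (Function.update m
    (D + 2) (s 0)) D (D + 6)) (D + 6) (s 0)) (s 0) 1) (D + 1) (D + 6) with hm₁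
  have hR₁ : Reach P B 7 ⟨0, m, s 0 :: i', o⟩ ⟨22, m₁, i', o⟩ :=
    .read (hP 0 (by norm_num)) hm addr_reg (by omega) fun hb =>
    .jz_of_ne (hP 1 (by norm_num)) hb (val_reg (Function.update_self ..)) (by omega)
    (.mov (hP 2 (by norm_num)) hb addr_reg val_imm (by omega) fun hb =>
    .mov (hP 3 (by norm_num)) hb (addr_ind (Function.update_self ..))
      (val_reg (by rw [Function.update_of_ne (by omega), Function.update_self])) (by omega)
      fun hb =>
    .mov (hP 4 (by norm_num)) hb (addr_ind (by rw [Function.update_of_ne (by omega),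
      Function.update_of_ne (by omega), Function.update_self])) val_imm (by omega) fun hb =>
    .mov (hP 5 (by norm_num)) hb addr_reg val_imm (by omega) fun hb =>
    .jump (hP 6 (by norm_num)) hb (.refl hb))
  -- Letters and border pointers left by an earlier word are harmless, since with q = 0 nothing is
  -- claimed about them. Only the flags carry over.
  have hS₁ : Stored D s (L ++ [s 0]) 0 0 m₁ :=
    { pos := by rw [hm₁, Function.update_of_ne (by omega), Function.update_of_ne (by omega),
        Function.update_of_ne (by omega), Function.update_self]
      border := by rw [hm₁, Function.update_self]
      letter := fun j hj => absurd hj (by omega)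
      failure := fun j hj hj' => absurd hj (by omega)
      flag := fun c hc hc' => by
        rw [hm₁, Function.update_of_ne (by omega)]
        by_cases hcs : c = s 0
        · rw [hcs, Function.update_self]; simp
        · rw [Function.update_of_ne hcs, Function.update_of_ne (by omega),
            Function.update_of_ne (by omega), Function.update_of_ne (by omega), hL c hc hc']
          simp [hcs] }
  have hl₁ : m₁ (D + 6 + 2 * 0) = s 0 := by
    rw [hm₁, Function.update_of_ne (by omega), Function.update_of_ne (by omega), Nat.mul_zero,
      Nat.add_zero, Function.update_self]
  obtain ⟨m₂, hS₂, hR₂⟩ := record_step (i := i') (o := o) hP (by omega) hR₁.bdd hS₁ hl₁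
    (isMaxBorder_one s)
  obtain ⟨k, m₃, hk, hS₃, hR₃⟩ := read_loop (i := i) (o := o) hP hn hs (by omega) hR₂.bdd hS₂
    (isMaxBorder_one s)
  have hkn := hk.1.1
  rw [show n + 1 - (0 + 1) = n by omega] at hR₃ hS₃
  obtain ⟨m₄, hR₄, h4, h4', hfr₄⟩ : ∃ m₄, Reach P B 2 ⟨26, m₃, i, o⟩ ⟨28, m₄, i, o⟩ ∧
      m₄ (D + 3) = 2 * (n + 1 - k) ∧ m₄ (D + 4) = 2 * (n + 1) ∧
      ∀ r, r ≠ D + 3 → r ≠ D + 4 → m₄ r = m₃ r := by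
    refine ⟨_, .sub (hP 26 (by norm_num)) hR₃.bdd addr_reg (val_reg hS₃.pos) (val_reg hS₃.border)
      (by omega) fun hb => .sub (hP 27 (by norm_num)) hb addr_reg
      (val_reg (by rw [Function.update_of_ne (by omega), hS₃.pos])) val_imm (by omega)
      fun hb => .refl hb, ?_, ?_, fun r hr hr' => ?_⟩
    · rw [Function.update_of_ne (by omega), Function.update_self]; omega
    · rw [Function.update_self]; omega
    · rw [Function.update_of_ne hr', Function.update_of_ne hr]
  obtain ⟨m₅, h5, hfr₅, hR₅⟩ := divide_loop (i := i) (o := o) (n := n + 1) hP (by omega) hR₄.bdd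
    (by rw [hfr₄ _ (by omega) (by omega), hS₃.pos]) h4 h4'
  have hp : rootLength (n + 1) k ≤ n + 1 := by rw [rootLength]; split_ifs <;> omega
  set p := rootLength (n + 1) k with hpdef
  have hR₆ : Reach P B 1 ⟨35, m₅, i, o⟩ ⟨36, Function.update m₅ (D + 5) (D + 6), i, o⟩ :=
    .mov (hP 35 (by norm_num)) hR₅.bdd addr_reg val_imm (by omega) fun hb => .refl hb
  obtain ⟨m₇, hfr₇, hR₇⟩ := write_loop (i := i) (o := o) (s := s) (t := 0) (y := p) hP hn (by omega)
    hR₆.bdd (fun j hj => by rw [Function.update_of_ne (by omega), hfr₅ _ (by omega) (by omega)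
      (by omega), hfr₄ _ (by omega) (by omega), hS₃.letter j hj])
    (by rw [Function.update_of_ne (by omega), h5]; rfl) (by rw [Function.update_self])
  have hR₈ : Reach P B 2 ⟨41, m₇, i, o ++ (List.range' 0 p).map s⟩
      ⟨0, m₇, i, o ++ (List.range' 0 p).map s ++ [1]⟩ :=
    .write (hP 41 (by norm_num)) hR₇.bdd val_imm
      (.jump (hP 42 (by norm_num)) hR₇.bdd (.refl hR₇.bdd))
  refine ⟨k, m₇, hk, fun c hc hc' => ?_, ?_⟩
  · rw [hfr₇ _ (by omega) (by omega), Function.update_of_ne (by omega), hfr₅ _ (by omega) (by omega)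
      (by omega), hfr₄ _ (by omega) (by omega), hS₃.flag c hc hc', List.append_assoc,
      List.singleton_append]
  · rw [List.range_eq_range']
    -- The pieces add up to at most 34(n + 1) + 1 steps for a word of length n + 1, well within the
    -- stated bound.
    exact (((((((hR₁.trans hR₂).trans hR₃).trans hR₄).trans hR₅).trans hR₆).trans hR₇).trans
      hR₈).mono (by omega)

variable {N : ℕ} {Γ : SimpleGraph (Fin N)}

theorem two_le_letterCode (l : Fin N × Bool) : 2 ≤ letterCode l := by
  rw [letterCode]; split_ifs <;> omega

theorem letterCode_lt (l : Fin N × Bool) : letterCode l < 2 * N + 2 := by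
  have := l.1.2
  rw [letterCode]; split_ifs <;> omega

theorem map_letterAt_range {w : Word N} {p : ℕ} (hp : p ≤ w.length) :
    (List.range p).map (letterAt w) = (w.take p).map letterCode := by
  refine List.ext_getElem (by simpa using hp) fun j hj hj' => ?_
  simp only [List.length_map, List.length_range] at hj
  simp [letterAt_eq (show j < w.length by omega)]

/-- Processing all words. -/
theorem words_loop (hP : StartsWith P (2 * N + 2)) {ws : List (Word N)}
    (hB : ∀ w ∈ ws, 2 * N + 2 + 2 * w.length + 20 ≤ B) (hne : ∀ w ∈ ws, w ≠ []) (hm : Bdd B m)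
    (hL : ∀ c, 2 ≤ c → c < 2 * N + 2 → m c = if c ∈ L then 1 else 0) :
    ∃ zs m', List.Forall₂ IsWordRoot ws zs ∧
      (∀ c, 2 ≤ c → c < 2 * N + 2 →
        m' c = if c ∈ L ++ ws.flatten.map letterCode then 1 else 0) ∧
      Reach P B (70 * ws.flatten.length + 2) ⟨0, m, encode ws, o⟩
        ⟨43, m', [], o ++ zs.flatMap fun z => z.map letterCode ++ [1]⟩ := by
  induction ws generalizing m L o with
  | nil =>
    -- Reading the end mark 0 leaves the loop for position 43, where the second part of the program
    -- begins.
    refine ⟨[], Function.update m (2 * N + 2 + 2) 0, .nil, fun c hc hc' => ?_, ?_⟩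
    · rw [Function.update_of_ne (by omega), hL c hc hc']
      simp
    · simp only [encode, List.flatMap_nil, List.nil_append, List.append_nil]
      exact .read (hP 0 (by norm_num)) hm addr_reg (Nat.zero_le _) fun hb =>
        .jz (hP 1 (by norm_num)) hb (val_reg (Function.update_self ..)) rfl (.refl hb)
  | cons w ws ih =>
    have hw0 := List.length_pos_iff.2 (hne w (by simp))
    obtain ⟨k, m₁, hk, hL₁, hR₁⟩ := word_loop (i := encode ws) (o := o) (s := letterAt w) hP
      (hB w (by simp)) hw0 (fun j hj => by
        rw [letterAt_eq hj]
        exact ⟨two_le_letterCode _, letterCode_lt _⟩) hm hL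
    obtain ⟨zs, m', hzs, hL', hR'⟩ := ih
      (o := o ++ (List.range (rootLength w.length k)).map (letterAt w) ++ [1])
      (fun v hv => hB v (by simp [hv])) (fun v hv => hne v (by simp [hv])) hR₁.bdd hL₁
    have hp : rootLength w.length k ≤ w.length := by rw [rootLength]; split_ifs <;> omega
    rw [map_letterAt_range hp] at hR₁ hR'
    rw [map_letterAt_range le_rfl, List.take_length] at hR₁ hL'
    refine ⟨w.take (rootLength w.length k) :: zs, m', .cons (isWordRoot_take hk) hzs,
      fun c hc hc' => ?_, ?_⟩
    · rw [hL' c hc hc', List.flatten_cons, List.map_append, List.append_assoc]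
    · have henc : encode (w :: ws) = w.map letterCode ++ 1 :: encode ws := by
        simp [encode]
      rw [henc, List.flatten_cons, List.length_append, List.flatMap_cons]
      have := (hR₁.trans hR').mono (show _ ≤ 70 * (w.length + ws.flatten.length) + 2 by omega)
      simpa only [List.append_assoc] using this

/-! ### The generators that commute with all factors -/

open Classical in
/-- The codes of the letters that do not commute with a generator. -/
noncomputable def neighborCodes (Γ : SimpleGraph (Fin N)) (a : Fin N) : List ℕ :=
  ((List.finRange N).filter fun b => Γ.Adj a b).flatMap
    fun b => [letterCode (b, true), letterCode (b, false)]

theorem mem_neighborCodes {a : Fin N} {c : ℕ} :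
    c ∈ neighborCodes Γ a ↔ ∃ l : Fin N × Bool, Γ.Adj a l.1 ∧ c = letterCode l := by
  simp only [neighborCodes, List.mem_flatMap, List.mem_filter, List.mem_finRange, true_and,
    decide_eq_true_eq, List.mem_cons, List.not_mem_nil, or_false]
  constructor
  · rintro ⟨b, hb, rfl | rfl⟩
    · exact ⟨(b, true), hb, rfl⟩
    · exact ⟨(b, false), hb, rfl⟩
  · rintro ⟨⟨b, _ | _⟩, hb, rfl⟩
    · exact ⟨b, hb, .inr rfl⟩
    · exact ⟨b, hb, .inl rfl⟩

theorem length_neighborCodes_le (a : Fin N) : (neighborCodes Γ a).length ≤ 2 * N := by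
  classical
  have h1 : (neighborCodes Γ a).length =
      2 * ((List.finRange N).filter fun b => Γ.Adj a b).length := by
    rw [neighborCodes, List.length_flatMap]
    simp [mul_comm]
  have h2 := List.length_filter_le (fun b => decide (Γ.Adj a b)) (List.finRange N)
  rw [List.length_finRange] at h2
  omega

/-- Adding up the contents of some registers. -/
def sumProgram (D : ℕ) (cs : List ℕ) : Program :=
  cs.map fun c => .add (.reg (D + 5)) (.reg (D + 5)) (.reg c)

/-- Writing the generators in a list all of whose neighbors are unflagged; `pc` is the position of
the first instruction. -/
noncomputable def centralProgram (Γ : SimpleGraph (Fin N)) (D : ℕ) : ℕ → List (Fin N) → Program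
  | _, [] => [.write (.imm 0), .halt]
  | pc, a :: as =>
    .mov (.reg (D + 5)) (.imm 0) :: (sumProgram D (neighborCodes Γ a) ++
      (.jz (.reg (D + 5)) (pc + (neighborCodes Γ a).length + 3) ::
       .jz (.imm 0) (pc + (neighborCodes Γ a).length + 5) ::
       .write (.imm (letterCode (a, true))) :: .write (.imm 1) ::
       centralProgram Γ D (pc + (neighborCodes Γ a).length + 5) as))

theorem getElem?_of_eq_append {α : Type*} {l p q : List α} {j : ℕ} (h : l = p ++ q) (t : ℕ)
    (hj : j = p.length + t) : l[j]? = q[t]? := by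
  rw [h, hj, List.getElem?_append_right (Nat.le_add_right _ _), Nat.add_sub_cancel_left]

/-- Summands are flags, so the accumulator grows by at most one per instruction. The accumulator
lies above all flag registers, so the summands do not change meanwhile. -/
theorem sum_run {cs : List ℕ} {pre post : Program} {pc t : ℕ}
    (hP : P = pre ++ (sumProgram D cs ++ post)) (hpc : pc = pre.length) (hm : Bdd B m)
    (ht : m (D + 5) = t) (hcs : ∀ c ∈ cs, c < D ∧ m c ≤ 1) (hB : t + cs.length ≤ B) :
    ∃ m', m' (D + 5) = t + (cs.map m).sum ∧ (∀ r, r ≠ D + 5 → m' r = m r) ∧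
      Reach P B cs.length ⟨pc, m, i, o⟩ ⟨pc + cs.length, m', i, o⟩ := by
  induction cs generalizing pre pc t m with
  | nil => exact ⟨m, by simpa using ht, fun _ _ => rfl, .refl hm⟩
  | cons c cs ih =>
    have hc := hcs c (by simp)
    have hI : P[pc]? = some (.add (.reg (D + 5)) (.reg (D + 5)) (.reg c)) :=
      getElem?_of_eq_append hP 0 hpc
    rw [List.length_cons] at hB
    have hR : Reach P B 1 ⟨pc, m, i, o⟩ ⟨pc + 1, Function.update m (D + 5) (t + m c), i, o⟩ :=
      .add hI hm addr_reg (val_reg ht) (val_reg rfl) (by omega) fun hb => .refl hb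
    have hne : ∀ c' ∈ cs, Function.update m (D + 5) (t + m c) c' = m c' := fun c' hc' => by
      have := hcs c' (by simp [hc'])
      rw [Function.update_of_ne (by omega)]
    obtain ⟨m', h1, h2, hR'⟩ := ih (pre := pre ++ [.add (.reg (D + 5)) (.reg (D + 5)) (.reg c)])
      (pc := pc + 1) (by rw [hP]; simp [sumProgram]) (by simp [hpc]) hR.bdd
      (Function.update_self ..)
      (fun c' hc' => by rw [hne c' hc']; exact hcs c' (by simp [hc'])) (by omega)
    refine ⟨m', ?_, fun r hr => by rw [h2 r hr, Function.update_of_ne hr], ?_⟩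
    · rw [h1, List.map_congr_left hne, List.map_cons, List.sum_cons, add_assoc]
    · rw [List.length_cons, show pc + (cs.length + 1) = pc + 1 + cs.length by ring]
      exact (hR.trans hR').mono (by omega)

-- A sum of flags vanishes exactly if no neighbour of the vertex has been read. Each vertex costs at
-- most 2N + 4 steps, a constant for a fixed graph.
open Classical in
theorem central_run {as : List (Fin N)} {pre : Program} {pc : ℕ}
    (hP : P = pre ++ centralProgram Γ (2 * N + 2) pc as) (hpc : pc = pre.length) (hm : Bdd B m)
    (hB : 2 * N + 1 ≤ B)
    (hL : ∀ c, 2 ≤ c → c < 2 * N + 2 → m c = if c ∈ L then 1 else 0) :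
    ∃ d, d.output = o ++ (as.filter fun a => ∀ c ∈ neighborCodes Γ a, c ∉ L).flatMap
        (fun a => [letterCode (a, true), 1]) ++ [0] ∧ step P d = none ∧
      Reach P B (as.length * (2 * N + 5) + 1) ⟨pc, m, i, o⟩ d := by
  induction as generalizing pre pc m o with
  | nil =>
    rw [centralProgram] at hP
    have hI : P[pc]? = some (.write (.imm 0)) := getElem?_of_eq_append hP 0 hpc
    have hI' : P[pc + 1]? = some .halt := getElem?_of_eq_append hP 1 (by rw [hpc])
    refine ⟨⟨pc + 1, m, i, o ++ [0]⟩, by simp, by rw [step, hI']; rfl, ?_⟩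
    exact Reach.mono (T := 1) (.write hI hm val_imm (.refl hm)) (by omega)
  | cons a as ih =>
    rw [centralProgram] at hP
    set cs := neighborCodes Γ a with hcs
    set e := pc + cs.length with he
    have hlen : cs.length ≤ 2 * N := length_neighborCodes_le a
    have hI : P[pc]? = some (.mov (.reg (2 * N + 2 + 5)) (.imm 0)) := getElem?_of_eq_append hP 0 hpc
    have hR₁ : Reach P B 1 ⟨pc, m, i, o⟩ ⟨pc + 1, Function.update m (2 * N + 2 + 5) 0, i, o⟩ :=
      .mov hI hm addr_reg val_imm (Nat.zero_le _) fun hb => .refl hb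
    have hcode : ∀ c ∈ cs, 2 ≤ c ∧ c < 2 * N + 2 := fun c hc => by
      obtain ⟨l, -, rfl⟩ := mem_neighborCodes.1 hc
      exact ⟨two_le_letterCode l, letterCode_lt l⟩
    have hL₁ : ∀ c, 2 ≤ c → c < 2 * N + 2 →
        Function.update m (2 * N + 2 + 5) 0 c = if c ∈ L then 1 else 0 := fun c hc hc' => by
      rw [Function.update_of_ne (by omega), hL c hc hc']
    obtain ⟨m₂, h2, hfr, hR₂⟩ := sum_run (i := i) (o := o) (cs := cs) (pc := pc + 1) (t := 0)
      (pre := pre ++ [.mov (.reg (2 * N + 2 + 5)) (.imm 0)])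
      (hP.trans (List.append_cons _ _ _)) (by simp [hpc])
      hR₁.bdd (Function.update_self ..)
      (fun c hc => ⟨(hcode c hc).2, by
        rw [hL₁ c (hcode c hc).1 (hcode c hc).2]; split_ifs <;> omega⟩) (by omega)
    rw [zero_add] at h2
    have hpc₂ : pc + 1 + cs.length = e + 1 := by omega
    rw [hpc₂] at hR₂
    have hL₂ : ∀ c, 2 ≤ c → c < 2 * N + 2 → m₂ c = if c ∈ L then 1 else 0 := fun c hc hc' => by
      rw [hfr c (by omega), hL₁ c hc hc']
    set Q := pre ++ .mov (.reg (2 * N + 2 + 5)) (.imm 0) :: sumProgram (2 * N + 2) cs with hQ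
    have hQl : Q.length = e + 1 := by simp [hQ, sumProgram, hpc, he]; omega
    have hP' : P = Q ++ (.jz (.reg (2 * N + 2 + 5)) (e + 3) :: .jz (.imm 0) (e + 5) ::
        .write (.imm (letterCode (a, true))) :: .write (.imm 1) ::
        centralProgram Γ (2 * N + 2) (e + 5) as) := by
      rw [hP, hQ]; simp
    have hI₁ : P[e + 1]? = some (.jz (.reg (2 * N + 2 + 5)) (e + 3)) :=
      getElem?_of_eq_append hP' 0 (by omega)
    have hI₂ : P[e + 2]? = some (.jz (.imm 0) (e + 5)) := getElem?_of_eq_append hP' 1 (by omega)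
    have hI₃ : P[e + 3]? = some (.write (.imm (letterCode (a, true)))) :=
      getElem?_of_eq_append hP' 2 (by omega)
    have hI₄ : P[e + 4]? = some (.write (.imm 1)) := getElem?_of_eq_append hP' 3 (by omega)
    have hP'' : P = (Q ++ [.jz (.reg (2 * N + 2 + 5)) (e + 3), .jz (.imm 0) (e + 5),
        .write (.imm (letterCode (a, true))), .write (.imm 1)]) ++
        centralProgram Γ (2 * N + 2) (e + 5) as := by
      rw [hP']; simp
    have hsum : (cs.map (Function.update m (2 * N + 2 + 5) 0)).sum = 0 ↔ ∀ c ∈ cs, c ∉ L := by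
      rw [List.sum_eq_zero_iff]
      simp only [List.mem_map, forall_exists_index, and_imp, forall_apply_eq_imp_iff₂]
      refine forall₂_congr fun c hc => ?_
      rw [hL₁ c (hcode c hc).1 (hcode c hc).2]
      simp
    by_cases hgood : ∀ c ∈ cs, c ∉ L
    · obtain ⟨d, hd, hd', hR'⟩ := ih (o := o ++ [letterCode (a, true)] ++ [1]) hP'' (by simp [hQl])
        hR₂.bdd hL₂
      refine ⟨d, ?_, hd', ?_⟩
      · rw [hd, List.filter_cons_of_pos (by simpa using hgood)]
        simp
      · have hR₃ : Reach P B 3 ⟨e + 1, m₂, i, o⟩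
            ⟨e + 5, m₂, i, o ++ [letterCode (a, true)] ++ [1]⟩ :=
          .jz hI₁ hR₂.bdd (val_reg h2) (hsum.2 hgood)
            (.write hI₃ hR₂.bdd val_imm (.write hI₄ hR₂.bdd val_imm (.refl hR₂.bdd)))
        refine (((hR₁.trans hR₂).trans hR₃).trans hR').mono ?_
        rw [List.length_cons, Nat.succ_mul as.length]
        omega
    · obtain ⟨d, hd, hd', hR'⟩ := ih (o := o) hP'' (by simp [hQl]) hR₂.bdd hL₂
      refine ⟨d, ?_, hd', ?_⟩
      · rw [hd, List.filter_cons_of_neg (by simpa using hgood)]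
      · have hR₃ : Reach P B 2 ⟨e + 1, m₂, i, o⟩ ⟨e + 5, m₂, i, o⟩ :=
          .jz_of_ne hI₁ hR₂.bdd (val_reg h2) (mt hsum.1 hgood)
            (.jump hI₂ hR₂.bdd (.refl hR₂.bdd))
        refine (((hR₁.trans hR₂).trans hR₃).trans hR').mono ?_
        rw [List.length_cons, Nat.succ_mul as.length]
        omega

/-! ### Assembly of the algorithm -/

/-- The program that computes the canonical generating set of the centralizer. -/
noncomputable def centralizerProgram (Γ : SimpleGraph (Fin N)) : Program :=
  rootProgram (2 * N + 2) ++ centralProgram Γ (2 * N + 2) 43 (List.finRange N)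

theorem startsWith_centralizerProgram : StartsWith (centralizerProgram Γ) (2 * N + 2) :=
  fun _ hj => List.getElem?_append_left hj

theorem length_le_length_flatten {ws : List (Word N)} {w : Word N} (h : w ∈ ws) :
    w.length ≤ ws.flatten.length :=
  (List.sublist_flatten_of_mem h).length_le

end RAAG

theorem propositionP {N : ℕ} (Γ : SimpleGraph (Fin N)) :
    ∃ (P : RAM.Program) (C : ℕ), ∀ ws : List (RAAG.Word N), RAAG.IsNonSplitDecomposition Γ ws →
      ∃ out : List (RAAG.Word N),
        RAM.ComputesWithin P (RAAG.encode ws) (RAAG.encode out)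
          (C * (ws.flatten.length + 1)) (C * (ws.flatten.length + 1)) ∧
        RAAG.IsCanonicalGeneratingList Γ ws out ∧
        Subgroup.closure {g | ∃ v ∈ out, g = RAAG.elt Γ v} =
          Subgroup.centralizer {RAAG.elt Γ ws.flatten} := by
  classical
  -- The summand 100 covers the 70n + 2 steps spent on the words and, with 2N, the largest register
  -- content. The product N(2N + 5) pays for the test of all vertices.
  refine ⟨RAAG.centralizerProgram Γ, 100 + 2 * N + N * (2 * N + 5), fun ws h => ?_⟩
  set C := 100 + 2 * N + N * (2 * N + 5) with hC
  set n := ws.flatten.length with hn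
  have hCn : 100 * n + C ≤ C * (n + 1) := by
    rw [Nat.mul_succ]
    exact Nat.add_le_add_right (Nat.mul_le_mul_right _ (by omega)) _
  obtain ⟨zs, m, hzs, hL, hR⟩ := RAAG.words_loop (L := []) (o := []) (ws := ws)
    (B := C * (n + 1)) (m := fun _ => 0) RAAG.startsWith_centralizerProgram
    (fun w hw => by have := RAAG.length_le_length_flatten hw; omega)
    (fun w hw => (h.nonSplit w hw).1) (fun _ => Nat.zero_le _) (by simp)
  obtain ⟨d, hd, hd', hR'⟩ := RAAG.central_run (i := [])
    (o := [] ++ zs.flatMap fun z => z.map RAAG.letterCode ++ [1]) (Γ := Γ)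
    (as := List.finRange N) (pre := RAAG.rootProgram (2 * N + 2)) (pc := 43) rfl rfl
    hR.bdd (by omega) hL
  set gs := (List.finRange N).filter fun a =>
    ∀ c ∈ RAAG.neighborCodes Γ a, c ∉ [] ++ ws.flatten.map RAAG.letterCode with hgs
  have hmem : ∀ a, a ∈ gs ↔ ∀ b ∈ RAAG.support ws.flatten, ¬ Γ.Adj a b := by
    intro a
    simp only [hgs, List.nil_append, List.mem_filter, List.mem_finRange, true_and,
      decide_eq_true_eq, RAAG.mem_neighborCodes, forall_exists_index, and_imp]
    constructor
    · rintro h1 b ⟨l, hl, rfl⟩ hab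
      exact h1 _ l hab rfl (List.mem_map_of_mem hl)
    · rintro h1 _ l hal rfl hl
      obtain ⟨l', hl', e⟩ := List.mem_map.1 hl
      rw [RAAG.letterCode_injective e] at hl'
      exact h1 l.1 ⟨l, hl', rfl⟩ hal
  refine ⟨zs ++ gs.map fun a => [(a, true)], ?_, ?_, h.closure_eq_centralizer hzs hmem⟩
  · have hout : RAAG.encode (zs ++ gs.map fun a => [(a, true)]) = d.output := by
      rw [hd]
      simp [RAAG.encode, List.flatMap_append, List.flatMap_map]
    rw [hout]
    refine ((hR.trans hR').mono ?_).computesWithin hd'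
    rw [List.length_finRange]
    omega
  · refine ⟨zs, gs, rfl, ?_, (List.nodup_finRange N).filter _, fun a => ?_⟩
    · rw [List.forall₂_iff_get] at hzs ⊢
      refine ⟨hzs.1, fun j hj hj' => ?_⟩
      have hw : ws.get ⟨j, hj⟩ ∈ ws := List.get_mem ..
      exact RAAG.isMinimalRoot_of_isWordRoot (h.cyclicNormalForm _ hw) (h.nonSplit _ hw)
        (hzs.2 j hj hj')
    · rw [hmem]
      exact forall₂_congr fun b _ => RAAG.gen_commute_iff.symm
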